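/- Let $\mathbb{D}$ be the open unit disc in $\mathbb{C}$ and $A$ the normalized Lebesgue area measure on $\mathbb{D}$. For $1<p<\infty$ let $B^p$ be the Besov space of all analytic functions $f$ in $\mathbb{D}$ with $\iint_{\mathbb{D}}|f'(z)|^p(1-|z|^2)^{p-2}\,dA(z)<\infty$, normed by $$\|f\|_{B^p}^p=|f(0)|^p+\iint_{\mathbb{D}}|f'(z)|^p(1-|z|^2)^{p-2}\,dA(z),$$ and let $B^p_0=B^p/\mathbb{C}$ be its quotient by the constant functions, with the quotient topology. For $\eta\in(0,1)$ and $a\in\mathbb{D}$ let $D_\eta(a)=\{z\in\mathbb{D}:|(a-z)/(1-\overline{a}z)|<\eta\}$ be the pseudo-hyperbolic disc. Let $1<p<\infty$ and let $g\in H^\infty$ be a bounded analytic function in $\mathbb{D}$ which is not identically zero. Put $G_c=\{z\in\mathbb{D}:|g(z)|>c\}$ for $c>0$, and let $S_g:B^p_0\to B^p_0$ be the operator induced by $$S_gf(z)=\int_0^z f'(w)g(w)\,dw,\qquad z\in\mathbb{D}.$$ Then $S_g$ has closed range on $B^p_0$ if and only if there exist $c>0$, $\delta>0$ and $\eta\in(0,1)$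 such that $$A(G_c\cap D_\eta(a))\ \ge\ \delta\,A(D_\eta(a))\qquad\text{for all }a\in\mathbb{D}.$$ -/

import Mathlib

open MeasureTheory Set Metric
open scoped Complex.UnitDisc

noncomputable section

namespace BesovRange

/-! ### The unit disc, its area measure, analytic functions on it -/

/-- The normalized area measure `A` on the unit disc, as a measure on `ℂ` carried by the disc
(the disc has Lebesgue measure `π`). -/
def areaMeasure : Measure ℂ :=
  (volume (ball (0 : ℂ) 1))⁻¹ • volume.restrict (ball (0 : ℂ) 1)

/-- Extension by zero to `ℂ` of a function on the unit disc. -/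
def extend (f : 𝔻 → ℂ) (z : ℂ) : ℂ :=
  open Classical in if h : ‖z‖ < 1 then f (Complex.UnitDisc.mk z h) else 0

/-- `f : 𝔻 → ℂ` is analytic in the unit disc. -/
def IsAnalytic (f : 𝔻 → ℂ) : Prop :=
  DifferentiableOn ℂ (extend f) (ball (0 : ℂ) 1)

/-- The derivative of a function on the unit disc (used at points of the disc only). -/
def derivative (f : 𝔻 → ℂ) (z : ℂ) : ℂ := deriv (extend f) z

/-- `g ∈ H^∞`: `g` is a bounded analytic function in the unit disc. -/
def IsHInfty (g : 𝔻 → ℂ) : Prop :=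
  IsAnalytic g ∧ ∃ M : ℝ, ∀ z, ‖g z‖ ≤ M

/-- The pseudo-hyperbolic distance `|z - w| / |1 - conj z * w|` on the unit disc. -/
def pseudoDist (z w : 𝔻) : ℝ :=
  ‖((z : ℂ) - w) / (1 - (starRingEnd ℂ) (z : ℂ) * w)‖

/-- The pseudo-hyperbolic disc `D_η(a)`, as a subset of `ℂ`. -/
def pseudoDisc (η : ℝ) (a : 𝔻) : Set ℂ :=
  {z : ℂ | ∃ w : 𝔻, (w : ℂ) = z ∧ pseudoDist a w < η}

/-- The set `G_c` of the points `z` of the disc with `|g z| > c`, as a subset of `ℂ`. -/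
def superlevel (g : 𝔻 → ℂ) (c : ℝ) : Set ℂ :=
  {z : ℂ | ∃ w : 𝔻, (w : ℂ) = z ∧ c < ‖g w‖}

/-! ### Elementary facts on extensions and derivatives -/

theorem extend_of_lt (f : 𝔻 → ℂ) {z : ℂ} (h : ‖z‖ < 1) :
    extend f z = f (Complex.UnitDisc.mk z h) := by
  simp [extend, h]

theorem extend_coe (f : 𝔻 → ℂ) (z : 𝔻) : extend f z = f z := by
  rw [extend_of_lt f z.norm_lt_one]; rfl

theorem extend_add (f h : 𝔻 → ℂ) : extend (f + h) = extend f + extend h := by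
  funext z; by_cases hz : ‖z‖ < 1 <;> simp [extend, hz]

theorem extend_smul (k : ℂ) (f : 𝔻 → ℂ) : extend (k • f) = k • extend f := by
  funext z; by_cases hz : ‖z‖ < 1 <;> simp [extend, hz]

theorem extend_zero : extend (0 : 𝔻 → ℂ) = 0 := by
  funext z; by_cases hz : ‖z‖ < 1 <;> simp [extend, hz]

theorem IsAnalytic.differentiableAt {f : 𝔻 → ℂ} (hf : IsAnalytic f) {z : ℂ}
    (hz : z ∈ ball (0 : ℂ) 1) : DifferentiableAt ℂ (extend f) z :=
  DifferentiableOn.differentiableAt hf (isOpen_ball.mem_nhds hz)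

theorem derivative_add {f h : 𝔻 → ℂ} (hf : IsAnalytic f) (hh : IsAnalytic h) {z : ℂ}
    (hz : z ∈ ball (0 : ℂ) 1) : derivative (f + h) z = derivative f z + derivative h z := by
  rw [derivative, extend_add]
  exact deriv_add (hf.differentiableAt hz) (hh.differentiableAt hz)

theorem derivative_smul (k : ℂ) (f : 𝔻 → ℂ) (z : ℂ) :
    derivative (k • f) z = k * derivative f z := by
  rw [derivative, extend_smul]
  exact deriv_const_smul_field k (extend f)

theorem IsAnalytic.continuousOn_derivative {f : 𝔻 → ℂ} (hf : IsAnalytic f) :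
    ContinuousOn (derivative f) (ball (0 : ℂ) 1) :=
  (DifferentiableOn.deriv hf isOpen_ball).continuousOn

/-- If `extend f` agrees on the disc with a function `F` having derivative `F'` there, then `f`
is analytic with derivative `F'`. -/
theorem isAnalytic_of_hasDerivAt {f : 𝔻 → ℂ} {F F' : ℂ → ℂ}
    (hF : ∀ z ∈ ball (0 : ℂ) 1, HasDerivAt F (F' z) z)
    (hfF : ∀ z : 𝔻, f z = F z) :
    IsAnalytic f ∧ ∀ z ∈ ball (0 : ℂ) 1, derivative f z = F' z := by
  have key : ∀ z ∈ ball (0 : ℂ) 1, HasDerivAt (extend f) (F' z) z := by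
    intro z hz
    refine (hF z hz).congr_of_eventuallyEq ?_
    filter_upwards [isOpen_ball.mem_nhds hz] with w hw
    rw [extend_of_lt f (by simpa using hw), hfF]; rfl
  exact ⟨fun z hz => (key z hz).differentiableAt.differentiableWithinAt,
    fun z hz => (key z hz).deriv⟩

theorem ae_mem_ball : ∀ᵐ z ∂areaMeasure, z ∈ ball (0 : ℂ) 1 :=
  Measure.ae_smul_measure (ae_restrict_mem measurableSet_ball) _

/-! ### The Besov space -/

/-- The function `|f'(z)|^p (1 - |z|^2)^(p - 2)`. -/
def besovDensity (p : ℝ) (f : 𝔻 → ℂ) (z : ℂ) : ℝ :=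
  ‖derivative f z‖ ^ p * (1 - ‖z‖ ^ 2) ^ (p - 2)

/-- The function `f' (1 - |z|^2)^((p - 2) / p)`: it lies in `L^p(A)` if and only if
`besovDensity p f` is integrable. -/
def weighted (p : ℝ) (f : 𝔻 → ℂ) (z : ℂ) : ℂ :=
  (((1 - ‖z‖ ^ 2) ^ ((p - 2) / p) : ℝ) : ℂ) * derivative f z

theorem weighted_aesm (p : ℝ) {f : 𝔻 → ℂ} (hf : IsAnalytic f) :
    AEStronglyMeasurable (weighted p f) areaMeasure := by
  have hm : AEStronglyMeasurable (derivative f) areaMeasure :=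
    (hf.continuousOn_derivative.aestronglyMeasurable measurableSet_ball).smul_measure _
  refine AEStronglyMeasurable.mul (Measurable.aestronglyMeasurable ?_) hm
  fun_prop

theorem norm_weighted {p : ℝ} (hp : 1 < p) (f : 𝔻 → ℂ) {z : ℂ} (hz : z ∈ ball (0 : ℂ) 1) :
    ‖weighted p f z‖ ^ p = besovDensity p f z := by
  have hz' : ‖z‖ < 1 := by simpa using hz
  have h0 : 0 ≤ 1 - ‖z‖ ^ 2 := by nlinarith [norm_nonneg z]
  have hp0 : p ≠ 0 := by linarith
  rw [weighted, norm_mul, Complex.norm_real, Real.norm_of_nonneg (Real.rpow_nonneg h0 _),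
    Real.mul_rpow (Real.rpow_nonneg h0 _) (norm_nonneg _), ← Real.rpow_mul h0,
    div_mul_cancel₀ _ hp0, besovDensity, mul_comm]

theorem memLp_weighted_iff {p : ℝ} (hp : 1 < p) {f : 𝔻 → ℂ} (hf : IsAnalytic f) :
    MemLp (weighted p f) (ENNReal.ofReal p) areaMeasure ↔
      Integrable (besovDensity p f) areaMeasure := by
  have hp0 : 0 < p := by linarith
  rw [← integrable_norm_rpow_iff (weighted_aesm p hf) (by simpa using hp0) (by simp),
    ENNReal.toReal_ofReal hp0.le]
  refine integrable_congr ?_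
  filter_upwards [ae_mem_ball] with z hz using norm_weighted hp f hz

theorem weighted_add_ae (p : ℝ) {f h : 𝔻 → ℂ} (hf : IsAnalytic f) (hh : IsAnalytic h) :
    weighted p (f + h) =ᵐ[areaMeasure] weighted p f + weighted p h := by
  filter_upwards [ae_mem_ball] with z hz
  simp only [weighted, Pi.add_apply, derivative_add hf hh hz, mul_add]

theorem weighted_smul (p : ℝ) (k : ℂ) (f : 𝔻 → ℂ) :
    weighted p (k • f) = k • weighted p f := by
  funext z
  simp only [weighted, Pi.smul_apply, derivative_smul, smul_eq_mul]
  ring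

theorem isAnalytic_add {f h : 𝔻 → ℂ} (hf : IsAnalytic f) (hh : IsAnalytic h) :
    IsAnalytic (f + h) := by
  rw [IsAnalytic, extend_add]
  exact DifferentiableOn.add hf hh

theorem isAnalytic_smul (k : ℂ) {f : 𝔻 → ℂ} (hf : IsAnalytic f) : IsAnalytic (k • f) := by
  rw [IsAnalytic, extend_smul]
  exact DifferentiableOn.const_smul hf k

/-- The vector space of the analytic functions `f` in the unit disc for which
`∬ |f'(z)|^p (1 - |z|^2)^(p - 2) dA(z)` is finite. -/
def besovSubmodule (p : ℝ) (hp : 1 < p) : Submodule ℂ (𝔻 → ℂ) where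
  carrier := {f | IsAnalytic f ∧ Integrable (besovDensity p f) areaMeasure}
  add_mem' := by
    rintro f h ⟨hf, hfi⟩ ⟨hh, hhi⟩
    have hs := isAnalytic_add hf hh
    refine ⟨hs, (memLp_weighted_iff hp hs).1 ?_⟩
    exact (memLp_congr_ae (weighted_add_ae p hf hh)).2
      (((memLp_weighted_iff hp hf).2 hfi).add ((memLp_weighted_iff hp hh).2 hhi))
  zero_mem' := by
    have hz : IsAnalytic (0 : 𝔻 → ℂ) := by
      rw [IsAnalytic, extend_zero]; exact differentiableOn_const 0
    refine ⟨hz, (memLp_weighted_iff hp hz).1 ?_⟩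
    have : weighted p (0 : 𝔻 → ℂ) = 0 := by
      simpa using weighted_smul p 0 (0 : 𝔻 → ℂ)
    rw [this]; exact MemLp.zero
  smul_mem' := by
    rintro k f ⟨hf, hfi⟩
    have hs := isAnalytic_smul k hf
    refine ⟨hs, (memLp_weighted_iff hp hs).1 ?_⟩
    rw [weighted_smul]
    exact ((memLp_weighted_iff hp hf).2 hfi).const_smul k

/-- The Besov space `B^p`, `1 < p < ∞`. It is a type of its own, so that it carries the topology
of the Besov norm below and not that of pointwise convergence. -/
def Besov (p : ℝ) (hp : 1 < p) : Type := besovSubmodule p hp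

variable {p : ℝ} {hp : 1 < p}

instance : AddCommGroup (Besov p hp) := inferInstanceAs (AddCommGroup (besovSubmodule p hp))

instance : Module ℂ (Besov p hp) := inferInstanceAs (Module ℂ (besovSubmodule p hp))

/-- The function on the disc underlying an element of `B^p`. -/
def Besov.fn (f : Besov p hp) : 𝔻 → ℂ := f.1

/-- The Besov norm
`‖f‖ = (|f(0)|^p + ∬ |f'(z)|^p (1 - |z|^2)^(p - 2) dA(z))^(1/p)`. -/
def besovNorm (f : Besov p hp) : ℝ :=
  (‖f.fn 0‖ ^ p + ∫ z, besovDensity p f.fn z ∂areaMeasure) ^ (1 / p)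

theorem Besov.isAnalytic (f : Besov p hp) : IsAnalytic f.fn := f.2.1

theorem Besov.memLp (f : Besov p hp) :
    MemLp (weighted p f.fn) (ENNReal.ofReal p) areaMeasure :=
  (memLp_weighted_iff hp f.2.1).2 f.2.2

theorem fn_add (f h : Besov p hp) : (f + h).fn = f.fn + h.fn := rfl

theorem fn_smul (k : ℂ) (f : Besov p hp) : (k • f).fn = k • f.fn := rfl

theorem fn_injective {f h : Besov p hp} (e : f.fn = h.fn) : f = h := Subtype.ext e

/-- The pair `(f(0), f' (1 - |z|^2)^((p - 2) / p))` in the `ℓ^p`-sum of `ℂ` and `L^p(A)`. -/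
def besovPair (f : Besov p hp) :
    WithLp (ENNReal.ofReal p) (ℂ × Lp ℂ (ENNReal.ofReal p) areaMeasure) :=
  WithLp.toLp _ (f.fn 0, f.memLp.toLp _)

theorem besovPair_add (f h : Besov p hp) : besovPair (f + h) = besovPair f + besovPair h := by
  have : (f + h).memLp.toLp _ = f.memLp.toLp _ + h.memLp.toLp _ := by
    rw [← MemLp.toLp_add]
    exact MemLp.toLp_congr _ _ (weighted_add_ae p f.2.1 h.2.1)
  rw [besovPair, this]; rfl

theorem besovPair_smul (k : ℂ) (f : Besov p hp) : besovPair (k • f) = k • besovPair f := by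
  have : (k • f).memLp.toLp _ = k • f.memLp.toLp _ := by
    rw [← MemLp.toLp_const_smul]
    exact MemLp.toLp_congr _ _ (Filter.EventuallyEq.of_eq (weighted_smul p k f.fn))
  rw [besovPair, this]; rfl

theorem one_le_ofReal (hp : 1 < p) : 1 ≤ ENNReal.ofReal p := by
  simpa using ENNReal.ofReal_le_ofReal hp.le

theorem besovNorm_eq (f : Besov p hp) :
    haveI : Fact (1 ≤ ENNReal.ofReal p) := ⟨one_le_ofReal hp⟩
    besovNorm f = ‖besovPair f‖ := by
  have : Fact (1 ≤ ENNReal.ofReal p) := ⟨one_le_ofReal hp⟩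
  have hp0 : 0 < p := by linarith
  have hint : 0 ≤ ∫ z, ‖weighted p f.fn z‖ ^ p ∂areaMeasure :=
    integral_nonneg fun z => Real.rpow_nonneg (norm_nonneg _) _
  rw [WithLp.prod_norm_eq_add (by simpa [ENNReal.toReal_ofReal hp0.le] using hp0), ENNReal.toReal_ofReal hp0.le, besovNorm]
  congr 2
  change _ = ‖f.memLp.toLp _‖ ^ p
  rw [Lp.norm_toLp, f.memLp.eLpNorm_eq_integral_rpow_norm (by simpa using hp0) (by simp),
    ENNReal.toReal_ofReal hp0.le, ENNReal.toReal_ofReal (Real.rpow_nonneg hint _),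
    Real.rpow_inv_rpow hint hp0.ne']
  refine integral_congr_ae ?_
  filter_upwards [ae_mem_ball] with z hz using (norm_weighted hp f.fn hz).symm

theorem areaMeasure_eq_zero_of_open {U : Set ℂ} (hU : IsOpen U) (hUb : U ⊆ ball (0 : ℂ) 1)
    (h : areaMeasure U = 0) : U = ∅ := by
  have h1 : (volume (ball (0 : ℂ) 1))⁻¹ ≠ 0 := by
    simp
  rw [areaMeasure, Measure.smul_apply, smul_eq_mul, mul_eq_zero,
    Measure.restrict_apply hU.measurableSet, inter_eq_left.2 hUb] at h
  exact (hU.measure_eq_zero_iff volume).1 (h.resolve_left h1)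

theorem derivative_eq_zero_of_ae {f : 𝔻 → ℂ} (hf : IsAnalytic f)
    (h : ∀ᵐ z ∂areaMeasure, derivative f z = 0) :
    ∀ z ∈ ball (0 : ℂ) 1, derivative f z = 0 := by
  have hU : IsOpen (ball (0 : ℂ) 1 ∩ derivative f ⁻¹' {0}ᶜ) :=
    hf.continuousOn_derivative.isOpen_inter_preimage isOpen_ball isOpen_compl_singleton
  have hnull : areaMeasure (ball (0 : ℂ) 1 ∩ derivative f ⁻¹' {0}ᶜ) = 0 :=
    measure_mono_null (fun z hz => hz.2) (ae_iff.1 h)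
  have he := areaMeasure_eq_zero_of_open hU inter_subset_left hnull
  intro z hz
  by_contra hne
  exact (Set.eq_empty_iff_forall_notMem.1 he) z ⟨hz, hne⟩

theorem eq_zero_of_besovPair {f : Besov p hp} (h : besovPair f = 0) : f = 0 := by
  have hp0 : p ≠ 0 := by linarith
  have h1 : f.fn 0 = 0 := congrArg (fun q => q.ofLp.1) h
  have h2 : f.memLp.toLp _ = 0 := congrArg (fun q => q.ofLp.2) h
  have h3 : weighted p f.fn =ᵐ[areaMeasure] 0 :=
    f.memLp.coeFn_toLp.symm.trans (h2 ▸ Lp.coeFn_zero _ _ _)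
  have h4 : ∀ᵐ z ∂areaMeasure, derivative f.fn z = 0 := by
    filter_upwards [h3, ae_mem_ball] with z hz hzb
    have hz' : ‖z‖ < 1 := by simpa using hzb
    have hpos : 0 < 1 - ‖z‖ ^ 2 := by nlinarith [norm_nonneg z]
    rcases mul_eq_zero.1 hz with h | h
    · exact absurd h (by exact_mod_cast (Real.rpow_pos_of_pos hpos _).ne')
    · exact h
  have h5 := derivative_eq_zero_of_ae f.2.1 h4
  apply fn_injective
  funext z
  have hc := isOpen_ball.is_const_of_deriv_eq_zero (convex_ball (0 : ℂ) 1).isPreconnected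
    f.2.1 (fun z hz => h5 z hz) (mem_ball_self one_pos) (by simpa using z.norm_lt_one :
      (z : ℂ) ∈ ball (0 : ℂ) 1)
  have hc0 : extend f.fn 0 = f.fn 0 := by simpa using extend_coe f.fn 0
  exact ((extend_coe f.fn z).symm.trans hc.symm).trans (hc0.trans h1)

/-- `B^p` with the Besov norm. -/
instance : NormedAddCommGroup (Besov p hp) :=
  haveI : Fact (1 ≤ ENNReal.ofReal p) := ⟨one_le_ofReal hp⟩
  AddGroupNorm.toNormedAddCommGroup
    { toFun := besovNorm
      map_zero' := by
        have : besovPair (0 : Besov p hp) = 0 := by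
          simpa using besovPair_smul 0 (0 : Besov p hp)
        rw [besovNorm_eq, this, norm_zero]
      add_le' := fun f h => by
        simp only [besovNorm_eq, besovPair_add]
        exact norm_add_le _ _
      neg' := fun f => by
        have : besovPair (-f) = -besovPair f := by
          simpa using besovPair_smul (-1) f
        rw [besovNorm_eq, besovNorm_eq, this, norm_neg]
      eq_zero_of_map_eq_zero' := fun f hf => by
        rw [besovNorm_eq, norm_eq_zero] at hf
        exact eq_zero_of_besovPair hf }

theorem norm_def (f : Besov p hp) : ‖f‖ = besovNorm f := rfl

instance : NormedSpace ℂ (Besov p hp) where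
  norm_smul_le k f := by
    have : Fact (1 ≤ ENNReal.ofReal p) := ⟨one_le_ofReal hp⟩
    rw [norm_def, norm_def, besovNorm_eq, besovNorm_eq, besovPair_smul]
    exact norm_smul_le _ _

/-- The subspace of the constant functions in `B^p`. -/
def constants (p : ℝ) (hp : 1 < p) : Submodule ℂ (Besov p hp) where
  carrier := {f | ∃ k : ℂ, ∀ z, f.fn z = k}
  add_mem' := by
    rintro f h ⟨k, hk⟩ ⟨l, hl⟩
    exact ⟨k + l, fun z => by rw [fn_add, Pi.add_apply, hk, hl]⟩
  zero_mem' := ⟨0, fun _ => rfl⟩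
  smul_mem' := by
    rintro l f ⟨k, hk⟩
    exact ⟨l * k, fun z => by rw [fn_smul, Pi.smul_apply, hk, smul_eq_mul]⟩

/-- The space `B^p_0 = B^p / ℂ` of Besov functions modulo the constants, with the quotient
topology, that is, the topology of the quotient norm
`(∬ |f'(z)|^p (1 - |z|^2)^(p - 2) dA(z))^(1/p)`. -/
abbrev BesovZero (p : ℝ) (hp : 1 < p) : Type := Besov p hp ⧸ constants p hp

/-! ### The integral operator -/

/-- `S_g f (z) = ∫_0^z f'(w) g(w) dw`, the integral being taken along the segment from `0`
to `z`. -/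
def integralFn (g f : 𝔻 → ℂ) (z : 𝔻) : ℂ :=
  ∫ t in (0 : ℝ)..1, derivative f (t * z) * extend g (t * z) * z

theorem integralFn_spec {g f : 𝔻 → ℂ} (hg : IsAnalytic g) (hf : IsAnalytic f) :
    IsAnalytic (integralFn g f) ∧
      ∀ z ∈ ball (0 : ℂ) 1, derivative (integralFn g f) z = derivative f z * extend g z := by
  have hd : DifferentiableOn ℂ (fun z => derivative f z * extend g z) (ball (0 : ℂ) 1) :=
    (DifferentiableOn.deriv hf isOpen_ball).mul hg
  obtain ⟨F, hF⟩ := hd.isExactOn_ball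
  refine isAnalytic_of_hasDerivAt (F := fun z => F z - F 0)
    (fun z hz => (hF z hz).sub_const _) fun z => ?_
  have hmem : ∀ t ∈ uIcc (0 : ℝ) 1, (t : ℂ) * z ∈ ball (0 : ℂ) 1 := by
    intro t ht
    rw [uIcc_of_le zero_le_one] at ht
    rw [mem_ball_zero_iff, norm_mul, Complex.norm_real, Real.norm_of_nonneg ht.1]
    exact (mul_le_of_le_one_left (norm_nonneg _) ht.2).trans_lt z.norm_lt_one
  have hder : ∀ t ∈ uIcc (0 : ℝ) 1, HasDerivAt (fun t : ℝ => F (t * z))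
      (derivative f (t * z) * extend g (t * z) * z) t := by
    intro t ht
    have h1 : HasDerivAt (fun t : ℝ => (t : ℂ) * z) (z : ℂ) t := by
      simpa using (Complex.ofRealCLM.hasDerivAt (x := t)).mul_const (z : ℂ)
    exact (hF _ (hmem t ht)).comp t h1
  have hcont : ContinuousOn (fun t : ℝ => derivative f (t * z) * extend g (t * z) * z)
      (uIcc (0 : ℝ) 1) := by
    refine ContinuousOn.mul ?_ continuousOn_const
    exact hd.continuousOn.comp (f := fun t : ℝ => (t : ℂ) * z)
      (by fun_prop) hmem
  have := intervalIntegral.integral_eq_sub_of_hasDerivAt hder hcont.intervalIntegrable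
  simpa [integralFn] using this

theorem integralFn_mem {g : 𝔻 → ℂ} (hg : IsHInfty g) (f : Besov p hp) :
    integralFn g f.fn ∈ besovSubmodule p hp := by
  obtain ⟨hga, M, hM⟩ := hg
  obtain ⟨ha, hd⟩ := integralFn_spec hga f.isAnalytic
  refine ⟨ha, (memLp_weighted_iff hp ha).1 ?_⟩
  refine f.memLp.of_le_mul (c := M) (weighted_aesm p ha) ?_
  filter_upwards [ae_mem_ball] with z hz
  have hz' : ‖z‖ < 1 := by simpa using hz
  have hgz : ‖extend g z‖ ≤ M := by rw [extend_of_lt g hz']; exact hM _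
  rw [weighted, weighted, hd z hz, ← mul_assoc, norm_mul, mul_comm M]
  exact mul_le_mul_of_nonneg_left hgz (norm_nonneg _)

/-- Two analytic functions with the same value at `0` and the same derivative are equal. -/
theorem eq_of_derivative {f h : 𝔻 → ℂ} (hf : IsAnalytic f) (hh : IsAnalytic h)
    (h0 : f 0 = h 0) (hd : ∀ z ∈ ball (0 : ℂ) 1, derivative f z = derivative h z) : f = h := by
  funext z
  have h0' : extend f 0 = extend h 0 := by
    have e1 : extend f 0 = f 0 := by simpa using extend_coe f 0
    have e2 : extend h 0 = h 0 := by simpa using extend_coe h 0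
    rw [e1, e2, h0]
  have := isOpen_ball.eqOn_of_deriv_eq (convex_ball (0 : ℂ) 1).isPreconnected hf hh
    hd (mem_ball_self one_pos) h0' (by simpa using z.norm_lt_one : (z : ℂ) ∈ ball (0 : ℂ) 1)
  rwa [extend_coe, extend_coe] at this

theorem integralFn_apply_zero (g f : 𝔻 → ℂ) : integralFn g f 0 = 0 := by
  simp [integralFn]

/-- The operator `S_g : B^p → B^p` for `g ∈ H^∞`. -/
def integralOp (p : ℝ) (hp : 1 < p) (g : 𝔻 → ℂ) (hg : IsHInfty g) :
    Besov p hp →ₗ[ℂ] Besov p hp where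
  toFun f := ⟨integralFn g f.fn, integralFn_mem hg f⟩
  map_add' f h := by
    apply fn_injective
    have sf := integralFn_spec hg.1 f.isAnalytic
    have sh := integralFn_spec hg.1 h.isAnalytic
    have ss := integralFn_spec hg.1 (f + h).isAnalytic
    refine eq_of_derivative ss.1 (isAnalytic_add sf.1 sh.1) ?_ fun z hz => ?_
    · change integralFn g _ 0 = integralFn g _ 0 + integralFn g _ 0
      simp only [integralFn_apply_zero, add_zero]
    · refine (ss.2 z hz).trans (Eq.trans ?_ (derivative_add sf.1 sh.1 hz).symm)
      rw [sf.2 z hz, sh.2 z hz, ← add_mul]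
      exact congrArg (· * extend g z) (derivative_add f.isAnalytic h.isAnalytic hz)
  map_smul' k f := by
    apply fn_injective
    have sf := integralFn_spec hg.1 f.isAnalytic
    have ss := integralFn_spec hg.1 (k • f).isAnalytic
    refine eq_of_derivative ss.1 (isAnalytic_smul k sf.1) ?_ fun z hz => ?_
    · change integralFn g _ 0 = k * integralFn g _ 0
      simp only [integralFn_apply_zero, mul_zero]
    · refine (ss.2 z hz).trans (Eq.trans ?_ (derivative_smul k _ z).symm)
      refine Eq.trans ?_ (congrArg (k * ·) (sf.2 z hz).symm)
      exact (congrArg (· * extend g z) (derivative_smul k f.fn z)).trans (mul_assoc _ _ _)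

theorem integralOp_fn (g : 𝔻 → ℂ) (hg : IsHInfty g) (f : Besov p hp) :
    (integralOp p hp g hg f).fn = integralFn g f.fn := rfl

theorem constants_le_comap (g : 𝔻 → ℂ) (hg : IsHInfty g) :
    constants p hp ≤ (constants p hp).comap (integralOp p hp g hg) := by
  rintro f ⟨k, hk⟩
  refine ⟨0, fun z => ?_⟩
  have hder : ∀ w ∈ ball (0 : ℂ) 1, derivative f.fn w = 0 :=
    (isAnalytic_of_hasDerivAt (F := fun _ => k) (F' := fun _ => 0)
      (fun z _ => hasDerivAt_const z k) hk).2
  have s := integralFn_spec hg.1 f.isAnalytic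
  have e : integralFn g f.fn = 0 := by
    have h0 := (besovSubmodule p hp).zero_mem.1
    refine eq_of_derivative s.1 h0 (integralFn_apply_zero _ _) fun w hw => ?_
    rw [s.2 w hw, hder w hw, zero_mul, derivative, extend_zero]
    simp
  rw [integralOp_fn, e]; rfl

/-- The operator `S_g : B^p_0 → B^p_0` for `g ∈ H^∞`, induced by `S_g : B^p → B^p`. -/
def integralOpZero (p : ℝ) (hp : 1 < p) (g : 𝔻 → ℂ) (hg : IsHInfty g) :
    BesovZero p hp →ₗ[ℂ] BesovZero p hp :=
  (constants p hp).mapQ (constants p hp) (integralOp p hp g hg) (constants_le_comap g hg)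

end BesovRange

end

noncomputable section

namespace BesovRange

open Filter Topology ENNReal ComplexConjugate

variable {p : ℝ} {hp : 1 < p}

/-! ### Möbius involutions of the disc and the invariant measure -/

/-! Write `λ` for the Möbius invariant measure `hypMeasure`. Up to the normalization of area, the
Besov energy of `f` is the `λ`-integral of `(|f'(z)| (1 - |z|^2))^p`, a density invariant under `f ↦
f ∘ φ_a`. Everything can therefore be estimated at `0` and moved to any `a`. Density of a set in the
discs `D_η(a)` means the same for area and for `λ`, because `1 - |z|^2` is comparable to `1 - |a|^2`
there (`exists_volume_density_iff`).

Closed range becomes a lower bound. The operator `f ↦ f(0) + S_g f` on `B^p` is bounded and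
injective, and its range is the preimage of the range of `S_g` under the quotient map. Since `B^p`
is complete, closed range is equivalent to this operator being bounded below
(`isClosed_range_integralOpZero_iff`). The bound compares the energy of `f` with the integral of the
same density multiplied by `|g|^p`.

If `G_c` is uniformly dense, the bound is Luecking's theorem (`exists_lintegral_hypEnergy_le`). Its
local form `exists_enorm_rpow_le` controls a holomorphic function at the centre by its integral over
a subset of definite area plus a small multiple of the integral over the disc. It combines the
sub-mean value property of `|K|^q` for very small `q` with Hölder's inequality. Integration over all
centres and Tonelli's theorem let half of the total energy be absorbed.

Conversely, the bound is tested on `φ_a - a`, whose energy does not depend on `a`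
(`exists_density_of_norm_le`). Outside `G_c` the factor `|g|^p` is too small to account for that
energy. Outside `D_η(a)` with `η` near `1` the test function has almost no energy. So `G_c` must
fill a definite part of `D_η(a)`. -/

/-- The Möbius involution `z ↦ (a - z) / (1 - conj a * z)` of the unit disc. -/
def moebius (a z : ℂ) : ℂ := (a - z) / (1 - conj a * z)

theorem moebius_denom_ne_zero {a z : ℂ} (ha : ‖a‖ < 1) (hz : ‖z‖ < 1) : 1 - conj a * z ≠ 0 := by
  intro h
  have h1 : ‖conj a * z‖ = 1 := by rw [← sub_eq_zero.1 h, norm_one]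
  rw [norm_mul, RCLike.norm_conj] at h1
  nlinarith [norm_nonneg a, norm_nonneg z]

/-- The Schwarz–Pick identity: `|1 - conj a * z|^2 - |a - z|^2` factors. It yields both the self-map
property and the comparability of weights on pseudo-hyperbolic discs. -/
theorem one_sub_norm_moebius_sq {a z : ℂ} (ha : ‖a‖ < 1) (hz : ‖z‖ < 1) :
    1 - ‖moebius a z‖ ^ 2 = (1 - ‖a‖ ^ 2) * (1 - ‖z‖ ^ 2) / ‖1 - conj a * z‖ ^ 2 := by
  have h := norm_ne_zero_iff.2 (moebius_denom_ne_zero ha hz)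
  rw [moebius, norm_div, div_pow, eq_div_iff (pow_ne_zero 2 h), sub_mul,
    div_mul_cancel₀ _ (pow_ne_zero 2 h)]
  simp only [← Complex.normSq_eq_norm_sq, Complex.normSq_apply, Complex.sub_re, Complex.sub_im,
    Complex.mul_re, Complex.mul_im, Complex.conj_re, Complex.conj_im, Complex.one_re,
    Complex.one_im]
  ring

theorem one_sub_norm_sq_pos {z : ℂ} (hz : ‖z‖ < 1) : 0 < 1 - ‖z‖ ^ 2 := by
  nlinarith [norm_nonneg z]

theorem norm_moebius_lt_one {a z : ℂ} (ha : ‖a‖ < 1) (hz : ‖z‖ < 1) : ‖moebius a z‖ < 1 := by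
  have h := norm_pos_iff.2 (moebius_denom_ne_zero ha hz)
  have h2 : 0 < 1 - ‖moebius a z‖ ^ 2 := by
    rw [one_sub_norm_moebius_sq ha hz]
    have := one_sub_norm_sq_pos ha
    have := one_sub_norm_sq_pos hz
    positivity
  nlinarith [norm_nonneg (moebius a z)]

theorem moebius_moebius {a z : ℂ} (ha : ‖a‖ < 1) (hz : ‖z‖ < 1) :
    moebius a (moebius a z) = z := by
  have h := moebius_denom_ne_zero ha hz
  have h' := moebius_denom_ne_zero ha (norm_moebius_lt_one ha hz)
  rw [moebius, div_eq_iff h']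
  simp only [moebius]
  generalize conj a = b at *
  have h2 : (a - z) / (1 - b * z) * (1 - b * z) = a - z := div_mul_cancel₀ _ h
  refine mul_right_cancel₀ h ?_
  linear_combination (-1 + z * b) * h2

theorem moebius_zero_right (a : ℂ) : moebius a 0 = a := by simp [moebius]

theorem norm_moebius_comm (a z : ℂ) : ‖moebius a z‖ = ‖moebius z a‖ := by
  have h : 1 - conj z * a = conj (1 - conj a * z) := by simp [mul_comm]
  rw [moebius, moebius, norm_div, norm_div, norm_sub_rev, h, RCLike.norm_conj]

theorem hasDerivAt_moebius {a z : ℂ} (ha : ‖a‖ < 1) (hz : ‖z‖ < 1) :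
    HasDerivAt (moebius a) (-(1 - ‖a‖ ^ 2 : ℝ) / (1 - conj a * z) ^ 2) z := by
  have h := moebius_denom_ne_zero ha hz
  have h1 : HasDerivAt (fun z => a - z) (-1) z := by
    simpa using (hasDerivAt_id z).const_sub a
  have h2 : HasDerivAt (fun z => 1 - conj a * z) (-conj a) z := by
    simpa using ((hasDerivAt_id z).const_mul (conj a)).const_sub 1
  have h3 := h1.div h2 h
  have e : -((1 - ‖a‖ ^ 2 : ℝ) : ℂ) = -1 * (1 - conj a * z) - (a - z) * -conj a := by
    rw [Complex.ofReal_sub, Complex.ofReal_pow, ← Complex.conj_mul']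
    push_cast
    ring
  rw [e]
  exact h3

/-- Equality in Schwarz–Pick for automorphisms; the invariance of `hypMeasure` and of `hypEnergy`
both come from it. -/
theorem norm_deriv_moebius {a z : ℂ} (ha : ‖a‖ < 1) (hz : ‖z‖ < 1) :
    ‖deriv (moebius a) z‖ * (1 - ‖z‖ ^ 2) = 1 - ‖moebius a z‖ ^ 2 := by
  rw [(hasDerivAt_moebius ha hz).deriv, one_sub_norm_moebius_sq ha hz, norm_div, norm_neg,
    Complex.norm_real, Real.norm_of_nonneg (one_sub_norm_sq_pos ha).le, norm_pow]
  ring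

theorem measurable_moebius (a : ℂ) : Measurable (moebius a) := by
  unfold moebius; fun_prop

theorem mapsTo_moebius {a : ℂ} (ha : ‖a‖ < 1) : MapsTo (moebius a) (ball 0 1) (ball 0 1) :=
  fun z hz => by simpa using norm_moebius_lt_one ha (by simpa using hz)

theorem image_moebius_ball {a : ℂ} (ha : ‖a‖ < 1) : moebius a '' ball 0 1 = ball 0 1 :=
  Subset.antisymm (mapsTo_moebius ha).image_subset fun z hz =>
    ⟨moebius a z, mapsTo_moebius ha hz, moebius_moebius ha (by simpa using hz)⟩

/-- Change of variables in the plane for injective holomorphic maps. -/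
theorem lintegral_image_eq_lintegral_norm_deriv {f : ℂ → ℂ} {s : Set ℂ} (hs : MeasurableSet s)
    (hf : ∀ z ∈ s, DifferentiableAt ℂ f z) (hinj : InjOn f s) (u : ℂ → ℝ≥0∞) :
    ∫⁻ z in f '' s, u z = ∫⁻ z in s, ENNReal.ofReal (‖deriv f z‖ ^ 2) * u (f z) := by
  rw [lintegral_image_eq_lintegral_abs_det_fderiv_mul volume hs
    (fun z hz => ((hf z hz).hasDerivAt.hasFDerivAt.restrictScalars ℝ).hasFDerivWithinAt) hinj]
  refine setLIntegral_congr_fun hs fun z _ => ?_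
  simp [ContinuousLinearMap.det, LinearMap.det_restrictScalars,
      Algebra.norm_complex_eq, Complex.normSq_eq_norm_sq]

/-- The Möbius invariant measure `(1 - |z|^2)^(-2) dx dy` of the disc. -/
def hypMeasure : Measure ℂ :=
  (volume.restrict (ball (0 : ℂ) 1)).withDensity fun z => ENNReal.ofReal ((1 - ‖z‖ ^ 2) ^ 2)⁻¹

instance : SFinite hypMeasure := by unfold hypMeasure; infer_instance

theorem lintegral_hypMeasure {u : ℂ → ℝ≥0∞} :
    ∫⁻ z, u z ∂hypMeasure =
      ∫⁻ z in ball (0 : ℂ) 1, ENNReal.ofReal ((1 - ‖z‖ ^ 2) ^ 2)⁻¹ * u z := by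
  rw [hypMeasure, lintegral_withDensity_eq_lintegral_mul_non_measurable _ (by fun_prop)]
  · rfl
  · exact Eventually.of_forall fun _ => ENNReal.ofReal_lt_top

theorem ae_hypMeasure_mem_ball : ∀ᵐ z ∂hypMeasure, z ∈ ball (0 : ℂ) 1 :=
  (withDensity_absolutelyContinuous _ _).ae_le (ae_restrict_mem measurableSet_ball)

/-- The Jacobian `|φ_a'|^2` cancels the ratio of the densities at `z` and `φ_a z`. The change of
variables holds for arbitrary `u`, so no measurability is asked. -/
theorem lintegral_moebius_hypMeasure {a : ℂ} (ha : ‖a‖ < 1) (u : ℂ → ℝ≥0∞) :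
    ∫⁻ z, u (moebius a z) ∂hypMeasure = ∫⁻ z, u z ∂hypMeasure := by
  rw [lintegral_hypMeasure, lintegral_hypMeasure]
  conv_rhs => rw [← image_moebius_ball ha]
  rw [lintegral_image_eq_lintegral_norm_deriv measurableSet_ball
    (fun z hz => (hasDerivAt_moebius ha (by simpa using hz)).differentiableAt)
    (fun z hz w hw e => by
      rw [← moebius_moebius ha (z := z) (by simpa using hz), e,
        moebius_moebius ha (by simpa using hw)])]
  refine setLIntegral_congr_fun measurableSet_ball fun z hz => ?_
  have hz' : ‖z‖ < 1 := by simpa using hz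
  have h1 := one_sub_norm_sq_pos hz'
  have h2 := one_sub_norm_sq_pos (norm_moebius_lt_one ha hz')
  rw [← mul_assoc, ← ENNReal.ofReal_mul (by positivity)]
  congr 2
  rw [← norm_deriv_moebius ha hz'] at h2 ⊢
  have h3 : ‖deriv (moebius a) z‖ ≠ 0 := by rintro h; simp [h] at h2
  field_simp

theorem hypMeasure_preimage_moebius {a : ℂ} (ha : ‖a‖ < 1) {s : Set ℂ} (hs : MeasurableSet s) :
    hypMeasure (moebius a ⁻¹' s) = hypMeasure s := by
  rw [← lintegral_indicator_one hs, ← lintegral_moebius_hypMeasure ha,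
    ← lintegral_indicator_one (measurable_moebius a hs)]
  rfl

/-- The disc `{|φ_a| < η}`. -/
def hypDisc (η : ℝ) (a : ℂ) : Set ℂ := {z | ‖z‖ < 1 ∧ ‖moebius a z‖ < η}

theorem measurableSet_hypDisc (η : ℝ) (a : ℂ) : MeasurableSet (hypDisc η a) :=
  (measurableSet_lt measurable_norm measurable_const).inter
    (measurableSet_lt (measurable_moebius a).norm measurable_const)

theorem hypDisc_subset_ball (η : ℝ) (a : ℂ) : hypDisc η a ⊆ ball 0 1 :=
  fun z hz => by simpa using hz.1

theorem pseudoDisc_eq (η : ℝ) (a : 𝔻) : pseudoDisc η a = hypDisc η a := by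
  ext z
  constructor
  · rintro ⟨w, rfl, h⟩
    exact ⟨w.norm_lt_one, h⟩
  · rintro ⟨hz, h⟩
    exact ⟨Complex.UnitDisc.mk z hz, rfl, h⟩

/-- The invariant measure of the part of `s` in `hypDisc η a`, computed after moving `a` to `0`. -/
theorem hypMeasure_inter_hypDisc {a : ℂ} (ha : ‖a‖ < 1) {s : Set ℂ} (hs : MeasurableSet s) {η : ℝ} :
    hypMeasure (s ∩ hypDisc η a) = hypMeasure (moebius a ⁻¹' s ∩ ball 0 η) := by
  rw [← hypMeasure_preimage_moebius ha (hs.inter (measurableSet_hypDisc η a))]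
  refine measure_congr ?_
  filter_upwards [ae_hypMeasure_mem_ball] with z hz
  have hz' : ‖z‖ < 1 := by simpa using hz
  have := norm_moebius_lt_one ha hz'
  apply propext
  change (_ ∧ _ ∧ _) ↔ (_ ∧ _)
  rw [moebius_moebius ha hz', mem_ball_zero_iff]
  tauto

theorem hypMeasure_hypDisc {a : ℂ} (ha : ‖a‖ < 1) (η : ℝ) :
    hypMeasure (hypDisc η a) = hypMeasure (ball 0 η) := by
  simpa using hypMeasure_inter_hypDisc ha MeasurableSet.univ (η := η)

theorem volume_le_hypMeasure {s : Set ℂ} (hs : MeasurableSet s) (hb : s ⊆ ball 0 1) :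
    volume s ≤ hypMeasure s := by
  rw [hypMeasure, withDensity_apply _ hs, Measure.restrict_restrict hs, inter_eq_left.2 hb,
    ← setLIntegral_one]
  refine setLIntegral_mono' hs fun z hz => ?_
  have hz' : ‖z‖ < 1 := by simpa using hb hz
  have := one_sub_norm_sq_pos hz'
  rw [← ENNReal.ofReal_one]
  refine ENNReal.ofReal_le_ofReal (one_le_inv_iff₀.2 ⟨by positivity, ?_⟩)
  exact pow_le_one₀ this.le (by nlinarith [norm_nonneg z])

theorem ofReal_mul_volume_le_hypMeasure {s : Set ℂ} (hs : MeasurableSet s) (hb : s ⊆ ball 0 1)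
    {M : ℝ} (hM : ∀ z ∈ s, 1 - ‖z‖ ^ 2 ≤ M) :
    ENNReal.ofReal (M ^ 2)⁻¹ * volume s ≤ hypMeasure s := by
  rw [hypMeasure, withDensity_apply _ hs, Measure.restrict_restrict hs, inter_eq_left.2 hb,
    ← setLIntegral_const]
  refine setLIntegral_mono' hs fun z hz => ENNReal.ofReal_le_ofReal ?_
  have hz' := one_sub_norm_sq_pos (z := z) (by simpa using hb hz)
  have := hM z hz
  gcongr

theorem hypMeasure_le_ofReal_mul_volume {s : Set ℂ} (hs : MeasurableSet s) (hb : s ⊆ ball 0 1)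
    {m : ℝ} (hm0 : 0 < m) (hm : ∀ z ∈ s, m ≤ 1 - ‖z‖ ^ 2) :
    hypMeasure s ≤ ENNReal.ofReal (m ^ 2)⁻¹ * volume s := by
  rw [hypMeasure, withDensity_apply _ hs, Measure.restrict_restrict hs, inter_eq_left.2 hb,
    ← setLIntegral_const]
  refine setLIntegral_mono' hs fun z hz => ENNReal.ofReal_le_ofReal ?_
  have := hm z hz
  gcongr

theorem hypMeasure_ball_lt_top {η : ℝ} (h1 : η < 1) : hypMeasure (ball 0 η) < ∞ := by
  rcases le_or_gt η 0 with h0 | h0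
  · simp [ball_eq_empty.2 h0]
  refine (hypMeasure_le_ofReal_mul_volume measurableSet_ball (ball_subset_ball h1.le)
    (m := 1 - η ^ 2) (by nlinarith) fun z hz => ?_).trans_lt
    (ENNReal.mul_lt_top ENNReal.ofReal_lt_top measure_ball_lt_top)
  have : ‖z‖ < η := by simpa using hz
  nlinarith [norm_nonneg z]

/-- On `hypDisc η a` the weight `1 - |z|^2` is comparable to `1 - |a|^2`. -/
theorem one_sub_norm_sq_bounds {a z : ℂ} {η : ℝ} (h1 : η < 1) (ha : ‖a‖ < 1)
    (hz : z ∈ hypDisc η a) :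
    (1 - η ^ 2) / 4 * (1 - ‖a‖ ^ 2) ≤ 1 - ‖z‖ ^ 2 ∧
      1 - ‖z‖ ^ 2 ≤ (1 - ‖a‖ ^ 2) / (1 - η) ^ 2 := by
  obtain ⟨hz, hη⟩ := hz
  set w := moebius a z with hw
  have hw1 := norm_moebius_lt_one ha hz
  -- With `z = φ_a w` and `|w| < η`, the Schwarz–Pick identity reduces both bounds to `1 - η ≤ |1 -
  -- conj a * w| ≤ 2`.
  rw [← moebius_moebius ha hz, ← hw, one_sub_norm_moebius_sq ha hw1]
  have hA := one_sub_norm_sq_pos ha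
  have hW := one_sub_norm_sq_pos hw1
  have hprod : ‖conj a * w‖ ≤ ‖w‖ := by
    rw [norm_mul, RCLike.norm_conj]; nlinarith [norm_nonneg w]
  have hlow : 1 - η ≤ ‖1 - conj a * w‖ := by
    have := norm_sub_norm_le (1 : ℂ) (conj a * w)
    rw [norm_one] at this; linarith
  have hup : ‖1 - conj a * w‖ ≤ 2 := by
    have := norm_sub_le (1 : ℂ) (conj a * w)
    rw [norm_one] at this; linarith
  have hpos : 0 < ‖1 - conj a * w‖ := by linarith
  have hwη : ‖w‖ ^ 2 ≤ η ^ 2 := by gcongr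
  constructor
  · rw [le_div_iff₀ (by positivity)]
    have : ‖1 - conj a * w‖ ^ 2 ≤ 4 := by nlinarith
    have h3 : 0 ≤ 1 - η ^ 2 := by nlinarith [norm_nonneg w]
    calc (1 - η ^ 2) / 4 * (1 - ‖a‖ ^ 2) * ‖1 - conj a * w‖ ^ 2
        ≤ (1 - η ^ 2) / 4 * (1 - ‖a‖ ^ 2) * 4 := by gcongr
      _ = (1 - ‖a‖ ^ 2) * (1 - η ^ 2) := by ring
      _ ≤ _ := by gcongr
  · have h4 : 0 < 1 - η := by linarith
    gcongr
    nlinarith [sq_nonneg ‖w‖]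

/-- Density of `s` in `hypDisc η a`, uniformly in `a`, may be measured by the area or by the
invariant measure. -/
theorem exists_volume_density_iff {s : Set ℂ} (hs : MeasurableSet s) {η : ℝ} (h0 : 0 < η)
    (h1 : η < 1) :
    (∃ δ : ℝ, 0 < δ ∧ ∀ a : ℂ, ‖a‖ < 1 →
        ENNReal.ofReal δ * volume (hypDisc η a) ≤ volume (s ∩ hypDisc η a)) ↔
      ∃ δ : ℝ, 0 < δ ∧ ∀ a : ℂ, ‖a‖ < 1 → ENNReal.ofReal δ ≤ hypMeasure (s ∩ hypDisc η a) := by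
  have hm1 : 0 < (1 - η ^ 2) / 4 := by nlinarith
  have hV0 : 0 < hypMeasure (ball 0 η) :=
    (measure_ball_pos volume 0 h0).trans_le
      (volume_le_hypMeasure measurableSet_ball (ball_subset_ball h1.le))
  have hVt := hypMeasure_ball_lt_top h1
  set m := (1 - η ^ 2) / 4
  set Λ := (hypMeasure (ball 0 η)).toReal
  have hΛ : hypMeasure (ball 0 η) = ENNReal.ofReal Λ := (ENNReal.ofReal_toReal hVt.ne).symm
  have hΛ0 : 0 < Λ := ENNReal.toReal_pos hV0.ne' hVt.ne
  have low : ∀ a : ℂ, ‖a‖ < 1 → ∀ t : Set ℂ, MeasurableSet t →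
      ENNReal.ofReal (((1 - ‖a‖ ^ 2) / (1 - η) ^ 2) ^ 2)⁻¹ * volume (t ∩ hypDisc η a) ≤
        hypMeasure (t ∩ hypDisc η a) := fun a ha t ht =>
    ofReal_mul_volume_le_hypMeasure (ht.inter (measurableSet_hypDisc η a))
      (inter_subset_right.trans (hypDisc_subset_ball η a))
      fun z hz => (one_sub_norm_sq_bounds h1 ha hz.2).2
  have up : ∀ a : ℂ, ‖a‖ < 1 → ∀ t : Set ℂ, MeasurableSet t →
      hypMeasure (t ∩ hypDisc η a) ≤
        ENNReal.ofReal ((m * (1 - ‖a‖ ^ 2)) ^ 2)⁻¹ * volume (t ∩ hypDisc η a) := fun a ha t ht =>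
    hypMeasure_le_ofReal_mul_volume (ht.inter (measurableSet_hypDisc η a))
      (inter_subset_right.trans (hypDisc_subset_ball η a))
      (mul_pos hm1 (one_sub_norm_sq_pos ha))
      fun z hz => (one_sub_norm_sq_bounds h1 ha hz.2).1
  have hη1 : 0 < 1 - η := by linarith
  constructor
  · rintro ⟨δ, hδ, h⟩
    -- The lower comparison is used for `s` and the upper one for the full disc. The powers of `1 -
    -- |a|^2` cancel and `λ(D_η(a)) = Λ` for every `a`, so the constant is uniform.
    refine ⟨(1 - η) ^ 4 * δ * m ^ 2 * Λ, by positivity, fun a ha => ?_⟩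
    have hA := one_sub_norm_sq_pos ha
    refine le_trans ?_ (low a ha s hs)
    refine le_trans ?_ (mul_le_mul_right (h a ha) _)
    have hu := up a ha univ MeasurableSet.univ
    rw [univ_inter, hypMeasure_hypDisc ha, hΛ] at hu
    have hu' := mul_le_mul_right hu (ENNReal.ofReal (δ * (1 - η) ^ 4 * m ^ 2))
    rw [← ENNReal.ofReal_mul (by positivity), ← mul_assoc, ← ENNReal.ofReal_mul (by positivity)]
      at hu'
    rw [← mul_assoc, ← ENNReal.ofReal_mul (by positivity)]
    refine le_trans (le_of_eq ?_) (hu'.trans (le_of_eq ?_))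
    · congr 1; ring
    · congr 2; field_simp
  · rintro ⟨δ, hδ, h⟩
    -- The two comparisons exchange roles: upper for `s`, lower for the full disc.
    refine ⟨(1 - η) ^ 4 * δ * m ^ 2 / Λ, by positivity,
      fun a ha => ?_⟩
    have hA := one_sub_norm_sq_pos ha
    have hu := (h a ha).trans (up a ha s hs)
    have hl := low a ha univ MeasurableSet.univ
    rw [univ_inter, hypMeasure_hypDisc ha, hΛ] at hl
    have hl' := mul_le_mul_right hl (ENNReal.ofReal (δ * m ^ 2 * (1 - ‖a‖ ^ 2) ^ 2 / Λ))
    have hu' := mul_le_mul_right hu (ENNReal.ofReal (m ^ 2 * (1 - ‖a‖ ^ 2) ^ 2))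
    rw [← ENNReal.ofReal_mul (by positivity), ← mul_assoc,
      ← ENNReal.ofReal_mul (by positivity)] at hl' hu'
    refine le_trans (le_of_eq ?_) (hl'.trans (le_trans (le_of_eq ?_)
      (hu'.trans (le_of_eq ?_))))
    · congr 2; field_simp
    · congr 1; field_simp
    · rw [show m ^ 2 * (1 - ‖a‖ ^ 2) ^ 2 * ((m * (1 - ‖a‖ ^ 2)) ^ 2)⁻¹ = 1 by field_simp]
      simp

/-! ### Sub-mean value inequalities for powers of moduli of holomorphic functions -/

/-- In Jensen's formula each zero `u` in the disc adds its multiplicity times `log (1 / |u|) ≥ 0` to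
the average. -/
theorem log_norm_le_circleAverage {K : ℂ → ℂ} (hK : AnalyticOnNhd ℂ K (closedBall 0 1))
    (h0 : K 0 ≠ 0) :
    Real.log ‖K 0‖ ≤ Real.circleAverage (fun z => Real.log ‖K z‖) 0 1 := by
  have hK' : AnalyticOnNhd ℂ K (closedBall 0 |(1 : ℝ)|) := by simpa using hK
  rw [hK'.circleAverage_log_norm one_ne_zero h0]
  refine le_add_of_nonneg_left (finsum_nonneg fun u => ?_)
  have hd := MeromorphicOn.AnalyticOnNhd.divisor_nonneg hK' u
  by_cases hu : u ∈ closedBall (0 : ℂ) |(1 : ℝ)|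
  · refine mul_nonneg (by exact_mod_cast hd) ?_
    -- The centre adds nothing, by the conventions `0⁻¹ = 0` and `log 0 = 0`.
    rcases eq_or_ne u 0 with rfl | hu0
    · simp
    · refine Real.log_nonneg ?_
      rw [one_mul, zero_sub, norm_neg]
      exact (one_le_inv₀ (norm_pos_iff.2 hu0)).2 (by simpa using hu)
  · simp [Function.locallyFinsuppWithin.apply_eq_zero_of_notMem _ hu]

/-- The tangent inequality `log t ≤ t - 1` at `t = (|K z| / |K 0|)^q` is averaged over the circle
and combined with `log_norm_le_circleAverage`; it takes the place of convexity of the exponential.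
-/
theorem norm_rpow_le_circleAverage {K : ℂ → ℂ} (hK : AnalyticOnNhd ℂ K (closedBall 0 1))
    {q : ℝ} (hq : 0 < q) :
    ‖K 0‖ ^ q ≤ Real.circleAverage (fun z => ‖K z‖ ^ q) 0 1 := by
  by_cases h0 : K 0 = 0
  · rw [h0, norm_zero, Real.zero_rpow hq.ne']
    exact Real.circleAverage_nonneg_of_nonneg fun z _ => by positivity
  have hA : 0 < ‖K 0‖ := norm_pos_iff.2 h0
  have hsub : sphere (0 : ℂ) |(1 : ℝ)| ⊆ closedBall 0 1 := by simpa using sphere_subset_closedBall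
  have hint : CircleIntegrable (fun z => ‖K z‖ ^ q) 0 1 := by
    refine ContinuousOn.circleIntegrable zero_le_one ?_
    exact ((hK.continuousOn.mono sphere_subset_closedBall).norm).rpow_const fun _ _ => Or.inr hq.le
  have hlog : CircleIntegrable (fun z => Real.log ‖K z‖) 0 1 :=
    MeromorphicOn.circleIntegrable_log_norm (hK.mono hsub).meromorphicOn
  classical
  -- At a zero of `K` the default `Real.log 0 = 0` could break the bound, so `L` takes there the
  -- constant term of the tangent bound. Zeros are isolated, and the average is unchanged.
  set L : ℂ → ℝ := fun z => if K z = 0 then Real.log ‖K 0‖ - 1 / q else Real.log ‖K z‖ with hL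
  have hev : (fun z => Real.log ‖K z‖) =ᶠ[codiscreteWithin (sphere 0 |(1 : ℝ)|)] L := by
    have := hK.preimage_zero_mem_codiscreteWithin h0 (mem_closedBall_self zero_le_one)
      ((convex_closedBall (0 : ℂ) 1).isConnected ⟨0, mem_closedBall_self zero_le_one⟩)
    filter_upwards [codiscreteWithin_mono hsub this] with z hz
    have hz' : K z ≠ 0 := hz
    simp [hL, hz']
  have hLint : CircleIntegrable L 0 1 := hlog.congr_codiscreteWithin hev
  have hbound : ∀ z ∈ sphere (0 : ℂ) |(1 : ℝ)|,
      L z ≤ (1 / (q * ‖K 0‖ ^ q)) • ‖K z‖ ^ q + (Real.log ‖K 0‖ - 1 / q) := by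
    intro z _
    by_cases hz : K z = 0
    · simp only [hL, hz, if_true]
      exact le_add_of_nonneg_left (smul_nonneg (by positivity) (by positivity))
    · have hz0 : 0 < ‖K z‖ := norm_pos_iff.2 hz
      simp only [hL, hz, if_false, smul_eq_mul]
      have h1 := Real.log_le_sub_one_of_pos (x := (‖K z‖ / ‖K 0‖) ^ q) (by positivity)
      rw [Real.log_rpow (by positivity), Real.log_div hz0.ne' hA.ne',
        Real.div_rpow hz0.le hA.le] at h1
      have h2 : Real.log ‖K z‖ - Real.log ‖K 0‖ ≤ (‖K z‖ ^ q / ‖K 0‖ ^ q - 1) / q := by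
        rw [le_div_iff₀ hq]; linarith
      have h3 : (‖K z‖ ^ q / ‖K 0‖ ^ q - 1) / q = 1 / (q * ‖K 0‖ ^ q) * ‖K z‖ ^ q - 1 / q := by
        field_simp
      linarith
  have hsm : CircleIntegrable (fun z => (1 / (q * ‖K 0‖ ^ q)) • ‖K z‖ ^ q) 0 1 :=
    IntervalIntegrable.const_mul hint _
  have hmono := Real.circleAverage_mono hLint (hsm.add (circleIntegrable_const _ _ _)) hbound
  rw [Real.circleAverage_add hsm (circleIntegrable_const _ _ _), Real.circleAverage_fun_smul,
    Real.circleAverage_const, ← Real.circleAverage_congr_codiscreteWithin hev one_ne_zero] at hmono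
  have h4 := (log_norm_le_circleAverage hK h0).trans hmono
  have h5 : 1 / q ≤ 1 / (q * ‖K 0‖ ^ q) * Real.circleAverage (fun z => ‖K z‖ ^ q) 0 1 := by
    rw [smul_eq_mul] at h4; linarith
  have hAq : 0 < ‖K 0‖ ^ q := by positivity
  rw [one_div_mul_eq_div, div_le_div_iff₀ hq (by positivity), one_mul, mul_comm] at h5
  nlinarith [h5]

theorem enorm_rpow_le_lintegral_circle {K : ℂ → ℂ} (hK : AnalyticOnNhd ℂ K (closedBall 0 1))
    {q : ℝ} (hq : 0 < q) :
    ENNReal.ofReal (2 * Real.pi) * ‖K 0‖ₑ ^ q ≤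
      ∫⁻ θ in Ioc 0 (2 * Real.pi), ‖K (circleMap 0 1 θ)‖ₑ ^ q := by
  have e : ∀ w : ℂ, ‖w‖ₑ ^ q = ENNReal.ofReal (‖w‖ ^ q) := fun w => by
    rw [← ofReal_norm, ENNReal.ofReal_rpow_of_nonneg (norm_nonneg _) hq.le]
  simp_rw [e]
  have hc : Continuous fun θ => ‖K (circleMap 0 1 θ)‖ ^ q := by
    refine Continuous.rpow_const (Continuous.norm ?_) fun _ => Or.inr hq.le
    exact hK.continuousOn.comp_continuous (continuous_circleMap 0 1)
      fun θ => circleMap_mem_closedBall 0 zero_le_one θ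
  rw [← ENNReal.ofReal_mul (by positivity), ← ofReal_integral_eq_lintegral_ofReal
    (hc.integrableOn_Ioc) (Eventually.of_forall fun θ => by positivity)]
  refine ENNReal.ofReal_le_ofReal ?_
  have := norm_rpow_le_circleAverage hK hq
  rw [Real.circleAverage_def, smul_eq_mul, intervalIntegral.integral_of_le (by positivity),
    inv_mul_eq_div, le_div_iff₀ (by positivity)] at this
  linarith

/-- The sub-mean value inequality for `|K|^q` over discs centred at `0`. -/
theorem enorm_rpow_mul_volume_le {K : ℂ → ℂ} (hK : DifferentiableOn ℂ K (ball 0 1)) {q : ℝ}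
    (hq : 0 < q) {η : ℝ} (h1 : η < 1) :
    ‖K 0‖ₑ ^ q * volume (ball (0 : ℂ) η) ≤ ∫⁻ z in ball 0 η, ‖K z‖ₑ ^ q := by
  set u : ℂ → ℝ≥0∞ := (ball 0 η).indicator fun z => ‖K z‖ₑ ^ q with hu
  have hum : Measurable u := by
    classical
    rw [hu, ← piecewise_eq_indicator]
    refine ContinuousOn.measurable_piecewise ?_ continuousOn_const measurableSet_ball
    exact ENNReal.continuous_rpow_const.comp_continuousOn
      (hK.continuousOn.mono (ball_subset_ball h1.le)).enorm
  have hrot : ∀ θ : ℝ, ∫⁻ z, u (circleMap 0 1 θ * z) = ∫⁻ z, u z := fun θ => by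
    have e : ∀ z : ℂ, circleMap 0 1 θ * z = rotation (Circle.exp θ) z := fun z => by
      simp [circleMap]
    simp_rw [e]
    exact (rotation (Circle.exp θ)).measurePreserving.lintegral_comp hum
  -- For fixed `z` the circle inequality is applied to `ξ ↦ K (ξ * z)`. Rotation invariance and
  -- Tonelli's theorem then replace polar coordinates.
  have hcirc : ∀ z, (ball (0 : ℂ) η).indicator
      (fun _ => ENNReal.ofReal (2 * Real.pi) * ‖K 0‖ₑ ^ q) z ≤
      ∫⁻ θ in Ioc 0 (2 * Real.pi), u (circleMap 0 1 θ * z) := by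
    intro z
    refine indicator_le' (f := fun _ => _) (g := fun z =>
      ∫⁻ θ in Ioc 0 (2 * Real.pi), u (circleMap 0 1 θ * z)) (fun z hz => ?_)
      (fun _ _ => zero_le) z
    have hz1 : ‖z‖ < η := by simpa using hz
    have hKz : AnalyticOnNhd ℂ (fun ξ => K (ξ * z)) (closedBall 0 1) := by
      refine (hK.analyticOnNhd isOpen_ball).comp (f := fun ξ => ξ * z)
        (fun ξ _ => by fun_prop) fun ξ hξ => ?_
      have : ‖ξ‖ ≤ 1 := by simpa using hξ
      rw [mem_ball_zero_iff, norm_mul]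
      nlinarith [norm_nonneg z, norm_nonneg ξ]
    have h := enorm_rpow_le_lintegral_circle hKz hq
    simp only [zero_mul] at h
    refine h.trans (lintegral_mono fun θ => ?_)
    have : circleMap 0 1 θ * z ∈ ball (0 : ℂ) η := by simpa using hz1
    simp [hu, indicator_of_mem this]
  have h := lintegral_mono (μ := volume) hcirc
  rw [lintegral_indicator measurableSet_ball, setLIntegral_const,
    lintegral_lintegral_swap] at h
  · simp only [hrot, lintegral_const, Measure.restrict_apply_univ, Real.volume_Ioc, sub_zero] at h
    rw [mul_assoc, mul_comm (∫⁻ z, u z)] at h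
    rw [ENNReal.mul_le_mul_iff_right (by simpa using Real.pi_pos) ENNReal.ofReal_ne_top] at h
    rwa [hu, lintegral_indicator measurableSet_ball] at h
  · refine (hum.comp ?_).aemeasurable
    exact ((continuous_circleMap 0 1).measurable.comp measurable_snd).mul measurable_fst

/-- Hölder's inequality with the weights `θ` and `1 - θ`, against the constant function `1`. -/
theorem setLIntegral_rpow_le (μ : Measure ℂ) (s : Set ℂ) {u : ℂ → ℝ≥0∞}
    (hu : AEMeasurable u (μ.restrict s)) {θ : ℝ} (h0 : 0 ≤ θ) (h1 : θ ≤ 1) :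
    ∫⁻ z in s, u z ^ θ ∂μ ≤ (∫⁻ z in s, u z ∂μ) ^ θ * μ s ^ (1 - θ) := by
  have := ENNReal.lintegral_mul_norm_pow_le hu (aemeasurable_const (b := (1 : ℝ≥0∞))) h0
    (sub_nonneg.2 h1) (by ring)
  simpa using this

/-- A real-variable inequality behind `exists_enorm_rpow_le`. -/
theorem exists_le_mul_of_rpow_le {V σ ε : ℝ} (hσ : 0 < σ) (hσV : σ ≤ V) (hε : 0 < ε) :
    ∃ θ C : ℝ, 0 < θ ∧ θ < 1 ∧ 0 < C ∧ ∀ x y t : ℝ, 0 ≤ x → 0 ≤ y → 0 ≤ t → ε * t ≤ y →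
      V * y ^ θ ≤ x ^ θ * V ^ (1 - θ) + t ^ θ * (V - σ) ^ (1 - θ) → y ≤ C * x := by
  have hV : 0 < V := hσ.trans_le hσV
  have hcont : ContinuousAt (fun θ : ℝ => (1 / ε) ^ θ * (V - σ) ^ (1 - θ)) 0 := by
    refine ContinuousAt.mul ?_ ?_
    · exact (Real.continuousAt_const_rpow (by positivity))
    · exact ContinuousAt.rpow continuousAt_const (by fun_prop) (Or.inr (by norm_num))
  -- At `θ = 0` the expression is `V - σ`. A small `θ > 0` thus leaves a gap `σ / 2`, and the `t`
  -- term can be absorbed into `V * y ^ θ`.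
  have hlt : ∀ᶠ θ in 𝓝[>] (0 : ℝ), (1 / ε) ^ θ * (V - σ) ^ (1 - θ) < V - σ / 2 := by
    refine (hcont.tendsto.mono_left nhdsWithin_le_nhds).eventually_lt_const ?_
    simp; linarith
  obtain ⟨θ, hθ, hθ0, hθ1⟩ := (hlt.and (Ioo_mem_nhdsGT (zero_lt_one' ℝ))).exists
  refine ⟨θ, (2 * V ^ (1 - θ) / σ) ^ (1 / θ), hθ0, hθ1, by positivity, ?_⟩
  intro x y t hx hy ht hty h
  have h1 : t ^ θ ≤ y ^ θ * (1 / ε) ^ θ := by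
    rw [← Real.mul_rpow hy (by positivity)]
    refine Real.rpow_le_rpow ht ?_ hθ0.le
    rw [mul_one_div, le_div_iff₀ hε]; linarith
  have h2 : t ^ θ * (V - σ) ^ (1 - θ) ≤ y ^ θ * (V - σ / 2) := by
    calc _ ≤ y ^ θ * (1 / ε) ^ θ * (V - σ) ^ (1 - θ) :=
          mul_le_mul_of_nonneg_right h1 (Real.rpow_nonneg (by linarith) _)
      _ = y ^ θ * ((1 / ε) ^ θ * (V - σ) ^ (1 - θ)) := by ring
      _ ≤ _ := mul_le_mul_of_nonneg_left hθ.le (Real.rpow_nonneg hy _)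
  have h3 : y ^ θ ≤ 2 * V ^ (1 - θ) / σ * x ^ θ := by
    rw [div_mul_eq_mul_div, le_div_iff₀ hσ]; linarith
  rw [← Real.rpow_le_rpow_iff hy (by positivity) hθ0, Real.mul_rpow (by positivity) hx,
    ← Real.rpow_mul (by positivity), one_div_mul_cancel hθ0.ne', Real.rpow_one]
  exact h3

/-- A holomorphic function is controlled at the centre of a disc by its integral over any subset
of definite area, up to a small multiple of the integral over the disc. -/
theorem exists_enorm_rpow_le {p η σ ε : ℝ} (hp : 0 < p) (h1 : η < 1) (hσ : 0 < σ)
    (hε : 0 < ε) :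
    ∃ C : ℝ, 0 < C ∧ ∀ K : ℂ → ℂ, DifferentiableOn ℂ K (ball 0 1) → ∀ E ⊆ ball (0 : ℂ) η,
      MeasurableSet E → ENNReal.ofReal σ ≤ volume E →
      ‖K 0‖ₑ ^ p ≤ ENNReal.ofReal C * (∫⁻ z in E, ‖K z‖ₑ ^ p) +
        ENNReal.ofReal ε * ∫⁻ z in ball 0 η, ‖K z‖ₑ ^ p := by
  set B : Set ℂ := ball 0 η with hB
  have hBtop : volume B ≠ ∞ := measure_ball_lt_top.ne
  set V := (volume B).toReal with hVdef
  have hV : volume B = ENNReal.ofReal V := (ENNReal.ofReal_toReal hBtop).symm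
  -- If `σ` exceeds the area of the disc, no set `E` qualifies and any constant serves.
  by_cases hσV : σ ≤ V
  swap
  · refine ⟨1, one_pos, fun K _ E hE _ hvol => absurd hσV (not_not.2 ?_)⟩
    have := hvol.trans (measure_mono hE)
    rw [hV, ENNReal.ofReal_le_ofReal_iff ENNReal.toReal_nonneg] at this
    exact this
  obtain ⟨θ, C, hθ0, hθ1, hC, key⟩ := exists_le_mul_of_rpow_le hσ hσV hε
  refine ⟨C, hC, fun K hK E hE hEm hvol => ?_⟩
  set u : ℂ → ℝ≥0∞ := fun z => ‖K z‖ₑ ^ p with hu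
  have hcont : ContinuousOn u (closedBall 0 η) :=
    ENNReal.continuous_rpow_const.comp_continuousOn
      (hK.continuousOn.mono (closedBall_subset_ball h1)).enorm
  have hmeas : AEMeasurable u (volume.restrict B) :=
    (hcont.mono ball_subset_closedBall).aemeasurable measurableSet_ball
  have hfin : ∫⁻ z in B, u z ≠ ∞ := by
    obtain ⟨M, hM⟩ := ((isCompact_closedBall (0 : ℂ) η).exists_bound_of_continuousOn
      (hK.continuousOn.mono (closedBall_subset_ball h1)))
    refine (lt_of_le_of_lt (setLIntegral_mono' (g := fun _ => ENNReal.ofReal M ^ p)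
      measurableSet_ball fun z hz => ?_) ?_).ne
    · refine ENNReal.rpow_le_rpow ?_ hp.le
      rw [← ofReal_norm]
      exact ENNReal.ofReal_le_ofReal (hM z (ball_subset_closedBall hz))
    · rw [setLIntegral_const]
      exact ENNReal.mul_lt_top (ENNReal.rpow_lt_top_of_nonneg hp.le ENNReal.ofReal_ne_top)
        measure_ball_lt_top
  have hsplit : ∫⁻ z in B, u z ^ θ = (∫⁻ z in E, u z ^ θ) + ∫⁻ z in B \ E, u z ^ θ := by
    conv_lhs => rw [← union_sdiff_cancel hE]
    exact lintegral_union (measurableSet_ball.diff hEm) disjoint_sdiff_right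
  have hDvol : volume (B \ E) ≤ ENNReal.ofReal (V - σ) := by
    rw [measure_sdiff hE hEm.nullMeasurableSet (measure_ne_top_of_subset hE hBtop), hV,
      ENNReal.ofReal_sub _ hσ.le]
    exact tsub_le_tsub_left hvol _
  have hX : ∫⁻ z in E, u z ≠ ∞ := ne_top_of_le_ne_top hfin (lintegral_mono_set hE)
  have hY : ∫⁻ z in B \ E, u z ≠ ∞ := ne_top_of_le_ne_top hfin (lintegral_mono_set sdiff_subset)
  -- The sub-mean value inequality with exponent `p * θ`, followed by Hölder separately on `E` and
  -- on `B \ E`, whose area is at most `V - σ`.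
  have hmean : u 0 ^ θ * ENNReal.ofReal V ≤
      (∫⁻ z in E, u z) ^ θ * ENNReal.ofReal V ^ (1 - θ) +
        (∫⁻ z in B \ E, u z) ^ θ * ENNReal.ofReal (V - σ) ^ (1 - θ) := by
    have h := enorm_rpow_mul_volume_le hK (mul_pos hp hθ0) h1
    simp_rw [ENNReal.rpow_mul] at h
    rw [← hV]
    refine h.trans ((hsplit.le).trans (add_le_add ?_ ?_))
    · refine (setLIntegral_rpow_le volume E (hmeas.mono_measure (Measure.restrict_mono hE le_rfl))
        hθ0.le hθ1.le).trans ?_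
      gcongr
    · refine (setLIntegral_rpow_le volume (B \ E)
        (hmeas.mono_measure (Measure.restrict_mono sdiff_subset le_rfl)) hθ0.le hθ1.le).trans ?_
      gcongr
  change u 0 ≤ _
  -- Either the `ε` term already dominates, or `u 0` exceeds it and gives the hypothesis `ε * t ≤ y`
  -- of the real inequality.
  by_cases hbad : u 0 ≤ ENNReal.ofReal ε * ∫⁻ z in B, u z
  · exact hbad.trans le_add_self
  refine le_trans ?_ le_self_add
  have hu0 : u 0 ≠ ∞ := ENNReal.rpow_ne_top_of_nonneg hp.le enorm_ne_top
  have hty : ENNReal.ofReal ε * ∫⁻ z in B \ E, u z ≤ u 0 := by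
    refine le_trans ?_ (not_le.1 hbad).le
    gcongr
    exact sdiff_subset
  have hVσ : 0 ≤ V - σ := sub_nonneg.2 hσV
  have hV0 : 0 < V := hσ.trans_le hσV
  have hθ1' : 0 ≤ 1 - θ := by linarith
  obtain ⟨x, hx, hxE⟩ : ∃ x : ℝ, 0 ≤ x ∧ ∫⁻ z in E, u z = ENNReal.ofReal x :=
    ⟨_, ENNReal.toReal_nonneg, (ENNReal.ofReal_toReal hX).symm⟩
  obtain ⟨t, ht, htE⟩ : ∃ t : ℝ, 0 ≤ t ∧ ∫⁻ z in B \ E, u z = ENNReal.ofReal t :=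
    ⟨_, ENNReal.toReal_nonneg, (ENNReal.ofReal_toReal hY).symm⟩
  obtain ⟨y, hy, hyE⟩ : ∃ y : ℝ, 0 ≤ y ∧ u 0 = ENNReal.ofReal y :=
    ⟨_, ENNReal.toReal_nonneg, (ENNReal.ofReal_toReal hu0).symm⟩
  rw [hxE, htE, hyE, ENNReal.ofReal_rpow_of_nonneg hx hθ0.le,
    ENNReal.ofReal_rpow_of_nonneg hy hθ0.le, ENNReal.ofReal_rpow_of_nonneg ht hθ0.le,
    ENNReal.ofReal_rpow_of_nonneg hV0.le hθ1', ENNReal.ofReal_rpow_of_nonneg hVσ hθ1',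
    ← ENNReal.ofReal_mul (by positivity), ← ENNReal.ofReal_mul (by positivity),
    ← ENNReal.ofReal_mul (by positivity), ← ENNReal.ofReal_add (by positivity) (by positivity),
    ENNReal.ofReal_le_ofReal_iff (by positivity)] at hmean
  rw [htE, hyE, ← ENNReal.ofReal_mul hε.le, ENNReal.ofReal_le_ofReal_iff hy] at hty
  rw [hxE, hyE, ← ENNReal.ofReal_mul hC.le]
  exact ENNReal.ofReal_le_ofReal (key x y t hx hy ht hty (by linarith))

/-! ### The Möbius invariant energy density -/

/-- The density `(|h(z)| (1 - |z|^2))^p` with respect to `hypMeasure`. -/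
def hypEnergy (p : ℝ) (h : ℂ → ℂ) (z : ℂ) : ℝ≥0∞ :=
  (‖h z‖ₑ * ENNReal.ofReal (1 - ‖z‖ ^ 2)) ^ p

theorem measurable_hypEnergy (p : ℝ) {h : ℂ → ℂ} (hh : Measurable h) :
    Measurable (hypEnergy p h) := by
  unfold hypEnergy; fun_prop

/-- The derivative of `f ∘ moebius a` when `h` is the derivative of `f`. -/
def moebiusPullback (a : ℂ) (h : ℂ → ℂ) (z : ℂ) : ℂ := h (moebius a z) * deriv (moebius a) z

theorem hypEnergy_moebiusPullback (p : ℝ) {a z : ℂ} (ha : ‖a‖ < 1) (hz : ‖z‖ < 1) (h : ℂ → ℂ) :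
    hypEnergy p (moebiusPullback a h) z = hypEnergy p h (moebius a z) := by
  rw [hypEnergy, hypEnergy, moebiusPullback, enorm_mul, mul_assoc, ← ofReal_norm (deriv _ _),
    ← ENNReal.ofReal_mul (norm_nonneg _), norm_deriv_moebius ha hz]

theorem differentiableOn_moebius {a : ℂ} (ha : ‖a‖ < 1) :
    DifferentiableOn ℂ (moebius a) (ball 0 1) := fun z hz =>
  (hasDerivAt_moebius ha (by simpa using hz)).differentiableAt.differentiableWithinAt

theorem differentiableOn_moebiusPullback {a : ℂ} (ha : ‖a‖ < 1) {h : ℂ → ℂ}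
    (hh : DifferentiableOn ℂ h (ball 0 1)) :
    DifferentiableOn ℂ (moebiusPullback a h) (ball 0 1) :=
  (hh.comp (differentiableOn_moebius ha) (mapsTo_moebius ha)).mul
    ((differentiableOn_moebius ha).deriv isOpen_ball)

/-- On `|z| < η` the factor `(1 - |z|^2)^p` is at least `(1 - η^2)^p`, and the density of
`hypMeasure` is at least `1`. -/
theorem setLIntegral_enorm_rpow_le {p η : ℝ} (hp : 0 < p) (h0 : 0 < η) (h1 : η < 1) {E : Set ℂ}
    (hE : MeasurableSet E) (hb : E ⊆ ball 0 η) (K : ℂ → ℂ) :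
    ∫⁻ z in E, ‖K z‖ₑ ^ p ≤
      ENNReal.ofReal ((1 - η ^ 2) ^ (-p)) * ∫⁻ z in E, hypEnergy p K z ∂hypMeasure := by
  have hη : 0 < 1 - η ^ 2 := by nlinarith
  have hb1 : E ⊆ ball 0 1 := hb.trans (ball_subset_ball h1.le)
  rw [← lintegral_const_mul' _ _ ENNReal.ofReal_ne_top, ← lintegral_indicator hE (μ := hypMeasure),
    lintegral_hypMeasure, ← lintegral_indicator hE, ← lintegral_indicator measurableSet_ball]
  refine lintegral_mono fun z => ?_
  refine indicator_le' (f := fun z => ‖K z‖ₑ ^ p) (fun z hz => ?_) (fun _ _ => zero_le) z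
  rw [indicator_of_mem (hb1 hz), indicator_of_mem hz]
  have hz1 : ‖z‖ < η := by simpa using hb hz
  have hw := one_sub_norm_sq_pos (hz1.trans h1)
  have hwη : 1 - η ^ 2 ≤ 1 - ‖z‖ ^ 2 := by nlinarith [norm_nonneg z]
  rw [hypEnergy, ENNReal.mul_rpow_of_nonneg _ _ hp.le, ENNReal.ofReal_rpow_of_pos hw,
    mul_comm (‖K z‖ₑ ^ p), ← mul_assoc, ← mul_assoc, ← ENNReal.ofReal_mul (by positivity),
    ← ENNReal.ofReal_mul (by positivity)]
  refine le_mul_of_one_le_left' ?_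
  rw [ENNReal.one_le_ofReal, mul_assoc]
  refine one_le_mul_of_one_le_of_one_le ?_ ?_
  · refine (one_le_inv₀ (by positivity)).2 (pow_le_one₀ hw.le (by nlinarith [norm_nonneg z]))
  · rw [Real.rpow_neg hη.le, inv_mul_eq_div, one_le_div (by positivity)]
    exact Real.rpow_le_rpow hη.le hwη hp.le

theorem setLIntegral_hypEnergy_moebiusPullback (p : ℝ) {a : ℂ} (ha : ‖a‖ < 1) (η : ℝ) {s : Set ℂ}
    (hs : MeasurableSet s) (h : ℂ → ℂ) :
    ∫⁻ z in moebius a ⁻¹' s ∩ ball 0 η, hypEnergy p (moebiusPullback a h) z ∂hypMeasure =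
      ∫⁻ z in s ∩ hypDisc η a, hypEnergy p h z ∂hypMeasure := by
  rw [← lintegral_indicator ((measurable_moebius a hs).inter measurableSet_ball),
    ← lintegral_indicator (hs.inter (measurableSet_hypDisc η a)),
    ← lintegral_moebius_hypMeasure ha ((s ∩ hypDisc η a).indicator _)]
  refine lintegral_congr_ae ?_
  filter_upwards [ae_hypMeasure_mem_ball] with z hz
  have hz' : ‖z‖ < 1 := by simpa using hz
  have hiff : z ∈ moebius a ⁻¹' s ∩ ball 0 η ↔ moebius a z ∈ s ∩ hypDisc η a := by
    have := norm_moebius_lt_one ha hz'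
    change (_ ∧ _) ↔ (_ ∧ _ ∧ _)
    rw [moebius_moebius ha hz', mem_ball_zero_iff]
    tauto
  by_cases hm : z ∈ moebius a ⁻¹' s ∩ ball 0 η
  · rw [indicator_of_mem hm, indicator_of_mem (hiff.1 hm), hypEnergy_moebiusPullback p ha hz']
  · rw [indicator_of_notMem hm, indicator_of_notMem (mt hiff.2 hm)]

/-- The invariant form of `exists_enorm_rpow_le`. -/
theorem exists_hypEnergy_le {p η σ ε : ℝ} (hp : 0 < p) (h0 : 0 < η) (h1 : η < 1) (hσ : 0 < σ)
    (hε : 0 < ε) :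
    ∃ C : ℝ, 0 < C ∧ ∀ h : ℂ → ℂ, DifferentiableOn ℂ h (ball 0 1) → ∀ a : ℂ, ‖a‖ < 1 →
      ∀ s : Set ℂ, MeasurableSet s → ENNReal.ofReal σ ≤ hypMeasure (s ∩ hypDisc η a) →
      hypEnergy p h a ≤ ENNReal.ofReal C * (∫⁻ z in s ∩ hypDisc η a, hypEnergy p h z ∂hypMeasure) +
        ENNReal.ofReal ε * ∫⁻ z in hypDisc η a, hypEnergy p h z ∂hypMeasure := by
  have hη : 0 < 1 - η ^ 2 := by nlinarith
  set d := (1 - η ^ 2) ^ (-p) with hd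
  have hd0 : 0 < d := by positivity
  -- The factor `(1 - η^2)^2` turns a lower bound for `λ` on `ball 0 η` into one for area. Returning
  -- from `‖K‖ₑ ^ p` to `hypEnergy` costs `d`, so `ε` is divided by `d` beforehand.
  obtain ⟨C, hC, H⟩ := exists_enorm_rpow_le (p := p) (σ := (1 - η ^ 2) ^ 2 * σ) (ε := ε / d) hp h1
    (by positivity) (by positivity)
  refine ⟨C * d, by positivity, fun h hh a ha s hs hσs => ?_⟩
  rw [hypMeasure_inter_hypDisc ha hs] at hσs
  have hEm := (measurable_moebius a hs).inter (measurableSet_ball (x := (0 : ℂ)) (ε := η))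
  have hvol : ENNReal.ofReal ((1 - η ^ 2) ^ 2 * σ) ≤ volume (moebius a ⁻¹' s ∩ ball 0 η) := by
    have := hσs.trans (hypMeasure_le_ofReal_mul_volume hEm
      (inter_subset_right.trans (ball_subset_ball h1.le)) hη fun z hz => ?_)
    · have h2 := mul_le_mul_right this (ENNReal.ofReal ((1 - η ^ 2) ^ 2))
      rw [← mul_assoc, ← ENNReal.ofReal_mul (by positivity), ← ENNReal.ofReal_mul (by positivity),
        mul_inv_cancel₀ (by positivity), ENNReal.ofReal_one, one_mul] at h2
      exact h2
    · have : ‖z‖ < η := by simpa using hz.2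
      nlinarith [norm_nonneg z]
  have key := H _ (differentiableOn_moebiusPullback ha hh) _ inter_subset_right hEm hvol
  have hzero : ‖moebiusPullback a h 0‖ₑ ^ p = hypEnergy p h a := by
    have := hypEnergy_moebiusPullback p ha (z := 0) (by simp) h
    rw [moebius_zero_right] at this
    rw [← this, hypEnergy]; simp
  rw [hzero] at key
  have e1 := setLIntegral_enorm_rpow_le hp h0 h1 hEm inter_subset_right (moebiusPullback a h)
  have e2 := setLIntegral_enorm_rpow_le hp h0 h1 measurableSet_ball Subset.rfl
    (moebiusPullback a h)
  rw [setLIntegral_hypEnergy_moebiusPullback p ha η hs] at e1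
  have e3 := setLIntegral_hypEnergy_moebiusPullback p ha η MeasurableSet.univ h
  rw [preimage_univ, univ_inter, univ_inter] at e3
  rw [e3] at e2
  refine key.trans (add_le_add ?_ ?_)
  · rw [ENNReal.ofReal_mul hC.le, mul_assoc]; gcongr
  · calc _ ≤ ENNReal.ofReal (ε / d) * _ := mul_le_mul_right e2 _
      _ = _ := by
        rw [← mul_assoc, ← ENNReal.ofReal_mul (by positivity), div_mul_cancel₀ _ hd0.ne']

theorem hypMeasure_ball_pos {η : ℝ} (h0 : 0 < η) (h1 : η < 1) : 0 < hypMeasure (ball 0 η) :=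
  (measure_ball_pos volume 0 h0).trans_le
    (volume_le_hypMeasure measurableSet_ball (ball_subset_ball h1.le))

/-- The density is bounded pointwise by the total energy. -/
theorem exists_hypEnergy_le_lintegral {p : ℝ} (hp : 0 < p) :
    ∃ C : ℝ, 0 < C ∧ ∀ h : ℂ → ℂ, DifferentiableOn ℂ h (ball 0 1) → ∀ a : ℂ, ‖a‖ < 1 →
      hypEnergy p h a ≤ ENNReal.ofReal C * ∫⁻ z, hypEnergy p h z ∂hypMeasure := by
  have h0 : (0 : ℝ) < 1 / 2 := by norm_num
  have h1 : (1 / 2 : ℝ) < 1 := by norm_num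
  have hΛ := hypMeasure_ball_pos h0 h1
  have hΛt := hypMeasure_ball_lt_top h1
  -- Taken with `s = univ`: the disc itself has the required measure, whatever its centre, and both
  -- integrals are at most the total energy.
  obtain ⟨C, hC, H⟩ := exists_hypEnergy_le (σ := (hypMeasure (ball 0 (1 / 2))).toReal) hp h0 h1
    (ENNReal.toReal_pos hΛ.ne' hΛt.ne) one_pos
  refine ⟨C + 1, by positivity, fun h hh a ha => ?_⟩
  have := H h hh a ha univ MeasurableSet.univ (by
    rw [univ_inter, hypMeasure_hypDisc ha, ENNReal.ofReal_toReal hΛt.ne])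
  refine this.trans ?_
  rw [ENNReal.ofReal_add hC.le zero_le_one, add_mul]
  gcongr <;> exact Measure.restrict_le_self

/-! ### Averaging over pseudo-hyperbolic discs and Luecking's theorem -/

theorem measurable_indicator_hypDisc (η : ℝ) {u : ℂ → ℝ≥0∞} (hu : Measurable u) :
    Measurable fun q : ℂ × ℂ => (hypDisc η q.1).indicator u q.2 := by
  have hD : MeasurableSet {q : ℂ × ℂ | q.2 ∈ hypDisc η q.1} := by
    refine MeasurableSet.inter (s₁ := {q : ℂ × ℂ | ‖q.2‖ < 1})
      (s₂ := {q : ℂ × ℂ | ‖moebius q.1 q.2‖ < η})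
      (measurableSet_lt measurable_snd.norm measurable_const)
      (measurableSet_lt (by unfold moebius; fun_prop) measurable_const)
  exact (hu.comp measurable_snd).indicator hD

theorem setLIntegral_inter_hypDisc (η : ℝ) (s : Set ℂ) (u : ℂ → ℝ≥0∞) (a : ℂ) :
    ∫⁻ z in s ∩ hypDisc η a, u z ∂hypMeasure =
      ∫⁻ z in s, (hypDisc η a).indicator u z ∂hypMeasure := by
  rw [lintegral_indicator (measurableSet_hypDisc η a),
    Measure.restrict_restrict (measurableSet_hypDisc η a), inter_comm]

theorem measurable_setLIntegral_hypDisc (η : ℝ) (s : Set ℂ) {u : ℂ → ℝ≥0∞} (hu : Measurable u) :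
    Measurable fun a => ∫⁻ z in s ∩ hypDisc η a, u z ∂hypMeasure := by
  simp_rw [setLIntegral_inter_hypDisc]
  exact (measurable_indicator_hypDisc η hu).lintegral_prod_right'

/-- Tonelli's theorem for integrals over the discs `hypDisc η a`. -/
theorem lintegral_setLIntegral_hypDisc (η : ℝ) {s : Set ℂ} (hs : MeasurableSet s)
    {u : ℂ → ℝ≥0∞} (hu : Measurable u) :
    ∫⁻ a, ∫⁻ z in s ∩ hypDisc η a, u z ∂hypMeasure ∂hypMeasure =
      hypMeasure (ball 0 η) * ∫⁻ z in s, u z ∂hypMeasure := by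
  simp_rw [setLIntegral_inter_hypDisc]
  rw [lintegral_lintegral_swap, ← lintegral_const_mul _ hu]
  · refine setLIntegral_congr_fun_ae hs ?_
    filter_upwards [ae_hypMeasure_mem_ball] with z hz _
    have hz' : ‖z‖ < 1 := by simpa using hz
    -- Membership is symmetric in `a` and `z`, so the inner integral is `u z` times the measure of
    -- `hypDisc η z`, which is independent of `z`.
    have : ∀ᵐ a ∂hypMeasure, (hypDisc η a).indicator u z =
        (hypDisc η z).indicator (fun _ => u z) a := by
      filter_upwards [ae_hypMeasure_mem_ball] with a ha
      have ha' : ‖a‖ < 1 := by simpa using ha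
      have : z ∈ hypDisc η a ↔ a ∈ hypDisc η z := by
        simp [hypDisc, ha', hz', norm_moebius_comm a z]
      by_cases hm : z ∈ hypDisc η a
      · rw [indicator_of_mem hm, indicator_of_mem (this.1 hm)]
      · rw [indicator_of_notMem hm, indicator_of_notMem (mt this.2 hm)]
    rw [lintegral_congr_ae this, lintegral_indicator (measurableSet_hypDisc η z),
      setLIntegral_const, hypMeasure_hypDisc hz', mul_comm]
  · exact (measurable_indicator_hypDisc η hu).aemeasurable

/-- Luecking's theorem: a set of uniformly positive density in the discs `hypDisc η a` carries a
definite part of the energy of every holomorphic function. -/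
theorem exists_lintegral_hypEnergy_le {p η σ : ℝ} (hp : 0 < p) (h0 : 0 < η) (h1 : η < 1)
    (hσ : 0 < σ) {s : Set ℂ} (hs : MeasurableSet s)
    (hdens : ∀ a : ℂ, ‖a‖ < 1 → ENNReal.ofReal σ ≤ hypMeasure (s ∩ hypDisc η a)) :
    ∃ C : ℝ, 0 < C ∧ ∀ h : ℂ → ℂ, DifferentiableOn ℂ h (ball 0 1) → Measurable h →
      ∫⁻ z, hypEnergy p h z ∂hypMeasure ≠ ∞ →
      ∫⁻ z, hypEnergy p h z ∂hypMeasure ≤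
        ENNReal.ofReal C * ∫⁻ z in s, hypEnergy p h z ∂hypMeasure := by
  have hΛ := hypMeasure_ball_pos h0 h1
  have hΛt := hypMeasure_ball_lt_top h1
  obtain ⟨Λ, hΛ0, hΛe⟩ : ∃ Λ : ℝ, 0 < Λ ∧ hypMeasure (ball 0 η) = ENNReal.ofReal Λ :=
    ⟨_, ENNReal.toReal_pos hΛ.ne' hΛt.ne, (ENNReal.ofReal_toReal hΛt.ne).symm⟩
  -- Tonelli's theorem contributes a factor `Λ`; this `ε` leaves the coefficient `1 / 2` on the
  -- total energy.
  obtain ⟨C, hC, H⟩ := exists_hypEnergy_le (ε := 1 / (2 * Λ)) hp h0 h1 hσ (by positivity)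
  refine ⟨2 * (C * Λ), by positivity, fun h hh hm hfin => ?_⟩
  have hF := measurable_hypEnergy p hm
  have hint : ∫⁻ z, hypEnergy p h z ∂hypMeasure ≤
      ENNReal.ofReal (C * Λ) * (∫⁻ z in s, hypEnergy p h z ∂hypMeasure) +
        ENNReal.ofReal (1 / 2) * ∫⁻ z, hypEnergy p h z ∂hypMeasure := by
    have h2 := lintegral_setLIntegral_hypDisc η MeasurableSet.univ hF
    simp only [univ_inter, Measure.restrict_univ] at h2
    calc _ ≤ ∫⁻ a, (ENNReal.ofReal C * (∫⁻ z in s ∩ hypDisc η a, hypEnergy p h z ∂hypMeasure) +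
          ENNReal.ofReal (1 / (2 * Λ)) * ∫⁻ z in hypDisc η a, hypEnergy p h z ∂hypMeasure)
            ∂hypMeasure := by
          refine lintegral_mono_ae ?_
          filter_upwards [ae_hypMeasure_mem_ball] with a ha
          have ha' : ‖a‖ < 1 := by simpa using ha
          exact H h hh a ha' s hs (hdens a ha')
      _ ≤ _ := by
          rw [lintegral_add_left ((measurable_setLIntegral_hypDisc η s hF).const_mul _),
            lintegral_const_mul' _ _ ENNReal.ofReal_ne_top,
            lintegral_const_mul' _ _ ENNReal.ofReal_ne_top, lintegral_setLIntegral_hypDisc η hs hF,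
            h2, hΛe, ← mul_assoc, ← mul_assoc, ← ENNReal.ofReal_mul hC.le,
            ← ENNReal.ofReal_mul (by positivity)]
          rw [show 1 / (2 * Λ) * Λ = 1 / 2 by field_simp]
  have hhalf : ENNReal.ofReal (1 / 2) * (∫⁻ z, hypEnergy p h z ∂hypMeasure) +
      ENNReal.ofReal (1 / 2) * (∫⁻ z, hypEnergy p h z ∂hypMeasure) =
        ∫⁻ z, hypEnergy p h z ∂hypMeasure := by
    rw [← add_mul, ← ENNReal.ofReal_add (by norm_num) (by norm_num)]
    norm_num
  conv_lhs at hint => rw [← hhalf]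
  -- Cancelling half of the total energy is legitimate because it is finite.
  have h3 := ENNReal.le_of_add_le_add_right (ENNReal.mul_ne_top ENNReal.ofReal_ne_top hfin) hint
  have h4 := mul_le_mul_right h3 (ENNReal.ofReal 2)
  rw [← mul_assoc, ← mul_assoc, ← ENNReal.ofReal_mul (by norm_num),
    ← ENNReal.ofReal_mul (by norm_num)] at h4
  simpa using h4

/-! ### The Besov norm through the invariant measure -/

theorem measurable_derivative (f : 𝔻 → ℂ) : Measurable (derivative f) := measurable_deriv _

theorem volume_ball_inv_ne_zero : (volume (ball (0 : ℂ) 1))⁻¹ ≠ 0 := by simp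

theorem volume_ball_inv_ne_top : (volume (ball (0 : ℂ) 1))⁻¹ ≠ ∞ :=
  ENNReal.inv_ne_top.2 (measure_ball_pos volume _ one_pos).ne'

/-- The integral `∬ |f'(z)|^p (1 - |z|^2)^(p - 2) dA(z)` as an extended nonnegative number. -/
def energy (p : ℝ) (f : 𝔻 → ℂ) : ℝ≥0∞ :=
  (volume (ball (0 : ℂ) 1))⁻¹ * ∫⁻ z, hypEnergy p (derivative f) z ∂hypMeasure

theorem lintegral_besovDensity (hp : 1 < p) (f : 𝔻 → ℂ) :
    ∫⁻ z, ENNReal.ofReal (besovDensity p f z) ∂areaMeasure = energy p f := by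
  rw [areaMeasure, lintegral_smul_measure, energy, lintegral_hypMeasure, smul_eq_mul]
  congr 1
  refine setLIntegral_congr_fun measurableSet_ball fun z hz => ?_
  have hw := one_sub_norm_sq_pos (z := z) (by simpa using hz)
  have hp0 : 0 ≤ p := by linarith
  rw [besovDensity, hypEnergy, ← ofReal_norm, ← ENNReal.ofReal_mul (norm_nonneg _),
    ENNReal.ofReal_rpow_of_nonneg (by positivity) hp0, ← ENNReal.ofReal_mul (by positivity),
    Real.mul_rpow (norm_nonneg _) hw.le, Real.rpow_sub hw, Real.rpow_two]
  congr 1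
  field_simp

theorem besovDensity_nonneg_ae (p : ℝ) (f : 𝔻 → ℂ) : 0 ≤ᵐ[areaMeasure] besovDensity p f := by
  filter_upwards [ae_mem_ball] with z hz
  have hw := one_sub_norm_sq_pos (z := z) (by simpa using hz)
  exact mul_nonneg (Real.rpow_nonneg (norm_nonneg _) _) (Real.rpow_nonneg hw.le _)

theorem measurable_besovDensity (p : ℝ) (f : 𝔻 → ℂ) : Measurable (besovDensity p f) := by
  have := measurable_derivative f
  unfold besovDensity
  fun_prop

theorem mem_besovSubmodule_iff (hp : 1 < p) {f : 𝔻 → ℂ} :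
    f ∈ besovSubmodule p hp ↔ IsAnalytic f ∧ energy p f ≠ ∞ := by
  rw [← lintegral_besovDensity hp, ← lt_top_iff_ne_top,
    ← hasFiniteIntegral_iff_ofReal (besovDensity_nonneg_ae p f)]
  exact and_congr_right fun _ =>
    ⟨fun h => h.2, fun h => ⟨(measurable_besovDensity p f).aestronglyMeasurable, h⟩⟩

theorem Besov.energy_ne_top (f : Besov p hp) : energy p f.fn ≠ ∞ :=
  ((mem_besovSubmodule_iff hp).1 f.2).2

/-- With `p`-th powers in `[0, ∞]` the value at `0` and the energy can be compared separately,
without roots. -/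
theorem enorm_rpow_eq (f : Besov p hp) : ‖f‖ₑ ^ p = ‖f.fn 0‖ₑ ^ p + energy p f.fn := by
  have hp0 : 0 < p := by linarith
  have hint : ∫ z, besovDensity p f.fn z ∂areaMeasure = (energy p f.fn).toReal := by
    rw [integral_eq_lintegral_of_nonneg_ae (besovDensity_nonneg_ae p f.fn)
      (measurable_besovDensity p f.fn).aestronglyMeasurable, lintegral_besovDensity hp]
  have hnn : 0 ≤ ‖f.fn 0‖ ^ p + (energy p f.fn).toReal := by positivity
  rw [← ofReal_norm, norm_def, besovNorm, hint, ENNReal.ofReal_rpow_of_nonneg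
    (Real.rpow_nonneg hnn _) hp0.le, ← Real.rpow_mul hnn, one_div_mul_cancel hp0.ne',
    Real.rpow_one, ENNReal.ofReal_add (by positivity) ENNReal.toReal_nonneg,
    ENNReal.ofReal_toReal f.energy_ne_top, ← ofReal_norm,
    ENNReal.ofReal_rpow_of_nonneg (norm_nonneg _) hp0.le]

theorem enorm_apply_zero_le (f : Besov p hp) : ‖f.fn 0‖ₑ ≤ ‖f‖ₑ := by
  have hp0 : 0 < p := by linarith
  rw [← ENNReal.rpow_le_rpow_iff hp0, enorm_rpow_eq]
  exact le_self_add

theorem energy_le (f : Besov p hp) : energy p f.fn ≤ ‖f‖ₑ ^ p := by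
  rw [enorm_rpow_eq]; exact le_add_self

theorem differentiableOn_derivative {f : 𝔻 → ℂ} (hf : IsAnalytic f) :
    DifferentiableOn ℂ (derivative f) (ball 0 1) := DifferentiableOn.deriv hf isOpen_ball

theorem lintegral_hypEnergy_derivative (p : ℝ) (f : 𝔻 → ℂ) :
    ∫⁻ z, hypEnergy p (derivative f) z ∂hypMeasure = volume (ball (0 : ℂ) 1) * energy p f := by
  rw [energy, ← mul_assoc, ENNReal.mul_inv_cancel (measure_ball_pos volume _ one_pos).ne'
    measure_ball_lt_top.ne, one_mul]

/-- Besov functions are Bloch functions. -/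
theorem exists_norm_derivative_le (p : ℝ) (hp : 1 < p) :
    ∃ C : ℝ, 0 < C ∧ ∀ f : Besov p hp, ∀ z : ℂ, ‖z‖ < 1 →
      ‖derivative f.fn z‖ * (1 - ‖z‖ ^ 2) ≤ C * ‖f‖ := by
  have hp0 : 0 < p := by linarith
  obtain ⟨C, hC, H⟩ := exists_hypEnergy_le_lintegral hp0
  obtain ⟨V, hV0, hV⟩ : ∃ V : ℝ, 0 < V ∧ volume (ball (0 : ℂ) 1) = ENNReal.ofReal V :=
    ⟨_, ENNReal.toReal_pos (measure_ball_pos volume _ one_pos).ne' measure_ball_lt_top.ne,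
      (ENNReal.ofReal_toReal measure_ball_lt_top.ne).symm⟩
  refine ⟨(C * V) ^ (1 / p), by positivity, fun f z hz => ?_⟩
  have hw := one_sub_norm_sq_pos hz
  have h1 := H _ (differentiableOn_derivative f.isAnalytic) z hz
  rw [lintegral_hypEnergy_derivative, hypEnergy, hV] at h1
  have h2 := h1.trans (mul_le_mul_right (mul_le_mul_right (energy_le f) _) _)
  rw [← ofReal_norm, ← ofReal_norm, ← ENNReal.ofReal_mul (norm_nonneg _),
    ENNReal.ofReal_rpow_of_nonneg (by positivity) hp0.le,
    ENNReal.ofReal_rpow_of_nonneg (by positivity) hp0.le, ← ENNReal.ofReal_mul hV0.le,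
    ← ENNReal.ofReal_mul hC.le, ENNReal.ofReal_le_ofReal_iff (by positivity), ← mul_assoc] at h2
  have h3 : ((C * V) ^ (1 / p) * ‖f‖) ^ p = C * V * ‖f‖ ^ p := by
    rw [Real.mul_rpow (by positivity) (by positivity), ← Real.rpow_mul (by positivity),
      one_div_mul_cancel hp0.ne', Real.rpow_one]
  rw [← Real.rpow_le_rpow_iff (by positivity) (by positivity) hp0, h3]
  exact h2

/-! ### Completeness of the Besov space -/

theorem hypEnergy_congr_ae {h k : ℂ → ℂ} (e : EqOn h k (ball 0 1)) :
    hypEnergy p h =ᵐ[hypMeasure] hypEnergy p k := by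
  filter_upwards [ae_hypMeasure_mem_ball] with z hz
  rw [hypEnergy, hypEnergy, e hz]

theorem derivative_sub {f h : 𝔻 → ℂ} (hf : IsAnalytic f) (hh : IsAnalytic h) {z : ℂ}
    (hz : z ∈ ball (0 : ℂ) 1) : derivative (f - h) z = derivative f z - derivative h z := by
  have : f - h = f + (-1 : ℂ) • h := by rw [neg_one_smul, sub_eq_add_neg]
  rw [this, derivative_add hf (isAnalytic_smul _ hh) hz, derivative_smul]
  ring

theorem isAnalytic_sub {f h : 𝔻 → ℂ} (hf : IsAnalytic f) (hh : IsAnalytic h) :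
    IsAnalytic (f - h) := by
  have : f - h = f + (-1 : ℂ) • h := by rw [neg_one_smul, sub_eq_add_neg]
  rw [this]; exact isAnalytic_add hf (isAnalytic_smul _ hh)

theorem fn_sub (f h : Besov p hp) : (f - h).fn = f.fn - h.fn := rfl

/-- Every holomorphic function on the disc is the derivative of an analytic function with a
prescribed value at `0`. -/
theorem exists_isAnalytic_derivative_eq {H : ℂ → ℂ} (hH : DifferentiableOn ℂ H (ball 0 1))
    (c : ℂ) : ∃ f : 𝔻 → ℂ, IsAnalytic f ∧ f 0 = c ∧ ∀ z ∈ ball (0 : ℂ) 1, derivative f z = H z := by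
  obtain ⟨F, hF⟩ := hH.isExactOn_ball
  refine ⟨fun z => F z - F 0 + c, ?_⟩
  have := isAnalytic_of_hasDerivAt (f := fun z : 𝔻 => F z - F 0 + c)
    (F := fun z => F z - F 0 + c) (F' := H)
    (fun z hz => ((hF z hz).sub_const _).add_const _) fun _ => rfl
  exact ⟨this.1, by simp, this.2⟩

/-- Lower semicontinuity of the energy. -/
theorem energy_le_of_tendsto {f : ℕ → 𝔻 → ℂ} {h : 𝔻 → ℂ}
    (hlim : ∀ z ∈ ball (0 : ℂ) 1,
      Tendsto (fun n => derivative (f n) z) atTop (𝓝 (derivative h z)))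
    {M : ℝ≥0∞} (hM : ∀ᶠ n in atTop, energy p (f n) ≤ M) : energy p h ≤ M := by
  have hpt : ∀ z ∈ ball (0 : ℂ) 1, hypEnergy p (derivative h) z =
      liminf (fun n => hypEnergy p (derivative (f n)) z) atTop := fun z hz => by
    refine (Tendsto.liminf_eq ?_).symm
    refine (ENNReal.continuous_rpow_const.tendsto _).comp ?_
    exact ENNReal.Tendsto.mul_const ((continuous_enorm.tendsto _).comp (hlim z hz))
      (Or.inr ENNReal.ofReal_ne_top)
  -- Fatou's lemma.
  have h1 : ∫⁻ z, hypEnergy p (derivative h) z ∂hypMeasure ≤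
      liminf (fun n => ∫⁻ z, hypEnergy p (derivative (f n)) z ∂hypMeasure) atTop := by
    refine le_trans (le_of_eq (lintegral_congr_ae ?_))
      (lintegral_liminf_le fun n => measurable_hypEnergy p (measurable_derivative (f n)))
    filter_upwards [ae_hypMeasure_mem_ball] with z hz using hpt z hz
  have h2 : liminf (fun n => ∫⁻ z, hypEnergy p (derivative (f n)) z ∂hypMeasure) atTop ≤
      volume (ball (0 : ℂ) 1) * M := by
    refine liminf_le_of_frequently_le' (Eventually.frequently ?_)
    filter_upwards [hM] with n hn
    rw [lintegral_hypEnergy_derivative]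
    gcongr
  have h3 := h1.trans h2
  rw [lintegral_hypEnergy_derivative, ENNReal.mul_le_mul_iff_right
    (measure_ball_pos volume _ one_pos).ne' measure_ball_lt_top.ne] at h3
  exact h3

/-- By the Bloch bound the derivatives of a Cauchy sequence converge locally uniformly, so the limit
is holomorphic and has a primitive with the limiting value at `0`. Lower semicontinuity of the
energy upgrades this to convergence in norm. -/
instance : CompleteSpace (Besov p hp) := by
  have hp0 : 0 < p := by linarith
  refine Metric.complete_of_cauchySeq_tendsto fun u hu => ?_
  obtain ⟨C, hC, hbloch⟩ := exists_norm_derivative_le p hp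
  have hval : CauchySeq fun n => (u n).fn 0 := by
    rw [Metric.cauchySeq_iff] at hu ⊢
    intro ε hε
    obtain ⟨N, hN⟩ := hu ε hε
    refine ⟨N, fun m hm n hn => lt_of_le_of_lt ?_ (hN m hm n hn)⟩
    rw [dist_eq_norm, dist_eq_norm]
    have := enorm_apply_zero_le (u m - u n)
    exact enorm_le_iff_norm_le.1 this
  obtain ⟨c, hc⟩ := cauchySeq_tendsto_of_complete hval
  have hdist : ∀ z : ℂ, ‖z‖ < 1 → ∀ m n, dist (derivative (u m).fn z) (derivative (u n).fn z) ≤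
      C / (1 - ‖z‖ ^ 2) * dist (u m) (u n) := fun z hz m n => by
    have := hbloch (u m - u n) z hz
    rw [fn_sub, derivative_sub (u m).isAnalytic (u n).isAnalytic (by simpa using hz)] at this
    rw [dist_eq_norm, dist_eq_norm, div_mul_eq_mul_div, le_div_iff₀ (one_sub_norm_sq_pos hz)]
    exact this
  have hunif : ∀ r < 1, UniformCauchySeqOn (fun n => derivative (u n).fn) atTop
      (ball (0 : ℂ) r) := fun r hr => by
    rw [Metric.uniformCauchySeqOn_iff]
    intro ε hε
    rcases le_or_gt r 0 with hr0 | hr0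
    · exact ⟨0, fun _ _ _ _ z hz => by simp [ball_eq_empty.2 hr0] at hz⟩
    have hr2 : 0 < 1 - r ^ 2 := by nlinarith
    obtain ⟨N, hN⟩ := Metric.cauchySeq_iff.1 hu (ε * (1 - r ^ 2) / C) (by positivity)
    refine ⟨N, fun m hm n hn z hz => ?_⟩
    have hz' : ‖z‖ < r := by simpa using hz
    have hlt := hN m hm n hn
    have hzr : 1 - r ^ 2 ≤ 1 - ‖z‖ ^ 2 := by nlinarith [norm_nonneg z]
    calc _ ≤ C / (1 - ‖z‖ ^ 2) * dist (u m) (u n) := hdist z (hz'.trans hr) m n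
      _ ≤ C / (1 - r ^ 2) * dist (u m) (u n) := by gcongr
      _ < C / (1 - r ^ 2) * (ε * (1 - r ^ 2) / C) := by gcongr
      _ = ε := by field_simp
  have hpoint : ∀ z : ℂ, ∃ w, z ∈ ball (0 : ℂ) 1 →
      Tendsto (fun n => derivative (u n).fn z) atTop (𝓝 w) := fun z => by
    by_cases hz : z ∈ ball (0 : ℂ) 1
    · obtain ⟨r, hzr, hr⟩ := exists_between (show ‖z‖ < 1 by simpa using hz)
      obtain ⟨w, hw⟩ := cauchySeq_tendsto_of_complete
        ((hunif r hr).cauchySeq (by simpa using hzr : z ∈ ball (0 : ℂ) r))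
      exact ⟨w, fun _ => hw⟩
    · exact ⟨0, fun h => absurd h hz⟩
  choose H hH using hpoint
  have hloc : TendstoLocallyUniformlyOn (fun n => derivative (u n).fn) H atTop (ball 0 1) := by
    rw [Metric.tendstoLocallyUniformlyOn_iff]
    intro ε hε z hz
    obtain ⟨r, hzr, hr⟩ := exists_between (show ‖z‖ < 1 by simpa using hz)
    refine ⟨ball 0 r, mem_nhdsWithin_of_mem_nhds (isOpen_ball.mem_nhds (by simpa using hzr)), ?_⟩
    exact Metric.tendstoUniformlyOn_iff.1 ((hunif r hr).tendstoUniformlyOn_of_tendsto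
      fun x hx => hH x (ball_subset_ball hr.le hx)) ε hε
  have hHd : DifferentiableOn ℂ H (ball 0 1) :=
    hloc.differentiableOn (Eventually.of_forall fun n =>
      differentiableOn_derivative (u n).isAnalytic) isOpen_ball
  obtain ⟨f, hfa, hf0, hfd⟩ := exists_isAnalytic_derivative_eq hHd c
  have henergy : ∀ (n : ℕ) (M : ℝ≥0∞), (∀ᶠ m in atTop, ‖u m - u n‖ₑ ^ p ≤ M) →
      energy p (f - (u n).fn) ≤ M := fun n M hM => by
    refine energy_le_of_tendsto (f := fun m => (u m - u n).fn) (fun z hz => ?_) ?_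
    · rw [derivative_sub hfa (u n).isAnalytic hz, hfd z hz]
      have : ∀ m, derivative (u m - u n).fn z = derivative (u m).fn z - derivative (u n).fn z :=
        fun m => derivative_sub (u m).isAnalytic (u n).isAnalytic hz
      simp_rw [this]
      exact (hH z hz).sub_const _
    · filter_upwards [hM] with m hm using (energy_le _).trans hm
  have hev : ∀ ε : ℝ, 0 < ε → ∃ N, ∀ n ≥ N, ∀ m ≥ N, ‖u m - u n‖ ≤ ε := fun ε hε => by
    obtain ⟨N, hN⟩ := Metric.cauchySeq_iff.1 hu ε hε
    exact ⟨N, fun n hn m hm => by rw [← dist_eq_norm]; exact (hN m hm n hn).le⟩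
  have hev' : ∀ ε : ℝ, 0 < ε → ∃ N, ∀ n ≥ N,
      energy p (f - (u n).fn) ≤ ENNReal.ofReal ε ^ p := fun ε hε => by
    obtain ⟨N, hN⟩ := hev ε hε
    refine ⟨N, fun n hn => henergy n _ ?_⟩
    filter_upwards [eventually_ge_atTop N] with m hm
    refine ENNReal.rpow_le_rpow ?_ hp0.le
    rw [← ofReal_norm]
    exact ENNReal.ofReal_le_ofReal (hN n hn m hm)
  have hmem : f ∈ besovSubmodule p hp := by
    obtain ⟨N, hN⟩ := hev' 1 one_pos
    have hsub : f - (u N).fn ∈ besovSubmodule p hp :=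
      (mem_besovSubmodule_iff hp).2 ⟨isAnalytic_sub hfa (u N).isAnalytic,
        ne_top_of_le_ne_top (by simp) (hN N le_rfl)⟩
    have := (besovSubmodule p hp).add_mem hsub (u N).2
    rwa [show f - (u N).fn + (u N).1 = f from sub_add_cancel _ _] at this
  refine ⟨⟨f, hmem⟩, Metric.tendsto_atTop.2 fun ε hε => ?_⟩
  -- The `p`-th powers of the two parts add up to at most `2 * (ε / 3) ^ p < ε ^ p`, as `3 ^ p ≥ 3`.
  obtain ⟨N, hN⟩ := hev' (ε / 3) (by positivity)
  obtain ⟨N', hN'⟩ := Metric.tendsto_atTop.1 hc (ε / 3) (by positivity)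
  refine ⟨max N N', fun n hn => ?_⟩
  set F : Besov p hp := ⟨f, hmem⟩ with hF
  have h1 := hN n (le_of_max_le_left hn)
  have h2 : ‖(F - u n).fn 0‖ₑ ^ p ≤ ENNReal.ofReal (ε / 3) ^ p := by
    refine ENNReal.rpow_le_rpow ?_ hp0.le
    rw [← ofReal_norm]
    refine ENNReal.ofReal_le_ofReal ?_
    have := (hN' n (le_of_max_le_right hn)).le
    rw [dist_comm, dist_eq_norm, ← hf0] at this
    exact this
  have h3 : ‖F - u n‖ₑ ^ p ≤ ENNReal.ofReal (ε / 3) ^ p + ENNReal.ofReal (ε / 3) ^ p := by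
    rw [enorm_rpow_eq]; exact add_le_add h2 h1
  rw [← ofReal_norm, ENNReal.ofReal_rpow_of_nonneg (norm_nonneg _) hp0.le,
    ENNReal.ofReal_rpow_of_nonneg (by positivity) hp0.le, ← ENNReal.ofReal_add (by positivity)
    (by positivity), ENNReal.ofReal_le_ofReal_iff (by positivity)] at h3
  rw [dist_comm, dist_eq_norm, ← Real.rpow_lt_rpow_iff (norm_nonneg _) hε.le hp0]
  have h4 : ε ^ p = 3 ^ p * (ε / 3) ^ p := by
    rw [← Real.mul_rpow (by norm_num) (by positivity)]; congr 1; ring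
  have h5 : (3 : ℝ) ≤ 3 ^ p := by
    simpa using Real.rpow_le_rpow_of_exponent_le (by norm_num : (1 : ℝ) ≤ 3) hp.le
  have h6 : 0 < (ε / 3) ^ p := by positivity
  nlinarith

/-! ### Closed range as a lower bound -/

theorem isAnalytic_const (k : ℂ) : IsAnalytic fun _ : 𝔻 => k :=
  (isAnalytic_of_hasDerivAt (F := fun _ => k) (F' := fun _ => 0)
    (fun z _ => hasDerivAt_const z k) fun _ => rfl).1

theorem derivative_const (k : ℂ) {z : ℂ} (hz : z ∈ ball (0 : ℂ) 1) :
    derivative (fun _ : 𝔻 => k) z = 0 :=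
  (isAnalytic_of_hasDerivAt (f := fun _ : 𝔻 => k) (F := fun _ => k) (F' := fun _ => 0)
    (fun z _ => hasDerivAt_const z k) fun _ => rfl).2 z hz

theorem energy_const (hp0 : 0 < p) (k : ℂ) : energy p (fun _ : 𝔻 => k) = 0 := by
  have : ∫⁻ z, hypEnergy p (derivative fun _ : 𝔻 => k) z ∂hypMeasure = 0 := by
    rw [lintegral_congr_ae (hypEnergy_congr_ae (k := 0) fun z hz => derivative_const k hz)]
    simp [hypEnergy, hp0]
  rw [energy, this, mul_zero]

/-- The constant function `1` in `B^p`. -/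
def Besov.one (p : ℝ) (hp : 1 < p) : Besov p hp :=
  ⟨fun _ => 1, (mem_besovSubmodule_iff hp).2
    ⟨isAnalytic_const 1, by rw [energy_const (by linarith)]; simp⟩⟩

theorem one_fn (z : 𝔻) : (Besov.one p hp).fn z = 1 := rfl

/-- Evaluation at `0`. -/
def evalZero (p : ℝ) (hp : 1 < p) : Besov p hp →ₗ[ℂ] ℂ where
  toFun f := f.fn 0
  map_add' _ _ := rfl
  map_smul' _ _ := rfl

/-- The operator `f ↦ f(0) + S_g f` on `B^p`. -/
def augmentedOp (p : ℝ) (hp : 1 < p) (g : 𝔻 → ℂ) (hg : IsHInfty g) :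
    Besov p hp →ₗ[ℂ] Besov p hp :=
  integralOp p hp g hg + (evalZero p hp).smulRight (Besov.one p hp)

theorem augmentedOp_fn {g : 𝔻 → ℂ} (hg : IsHInfty g) (f : Besov p hp) (z : 𝔻) :
    (augmentedOp p hp g hg f).fn z = integralFn g f.fn z + f.fn 0 := by
  change integralFn g f.fn z + f.fn 0 * 1 = _
  rw [mul_one]

theorem augmentedOp_fn_zero {g : 𝔻 → ℂ} (hg : IsHInfty g) (f : Besov p hp) :
    (augmentedOp p hp g hg f).fn 0 = f.fn 0 := by
  rw [augmentedOp_fn, integralFn_apply_zero, zero_add]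

theorem derivative_augmentedOp {g : 𝔻 → ℂ} (hg : IsHInfty g) (f : Besov p hp) {z : ℂ}
    (hz : z ∈ ball (0 : ℂ) 1) :
    derivative (augmentedOp p hp g hg f).fn z = derivative f.fn z * extend g z := by
  have e : (augmentedOp p hp g hg f).fn = integralFn g f.fn + fun _ => f.fn 0 :=
    funext (augmentedOp_fn hg f)
  have s := integralFn_spec hg.1 f.isAnalytic
  rw [e, derivative_add s.1 (isAnalytic_const _) hz, derivative_const _ hz, add_zero, s.2 z hz]

theorem enorm_augmentedOp_rpow {g : 𝔻 → ℂ} (hg : IsHInfty g) (f : Besov p hp) :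
    ‖augmentedOp p hp g hg f‖ₑ ^ p =
      ‖f.fn 0‖ₑ ^ p + energy p (augmentedOp p hp g hg f).fn := by
  rw [enorm_rpow_eq, augmentedOp_fn_zero]

theorem hypEnergy_augmentedOp {g : 𝔻 → ℂ} (hg : IsHInfty g) (f : Besov p hp) {z : ℂ}
    (hz : z ∈ ball (0 : ℂ) 1) :
    hypEnergy p (derivative (augmentedOp p hp g hg f).fn) z =
      ‖extend g z‖ₑ ^ p * hypEnergy p (derivative f.fn) z := by
  have hp0 : 0 ≤ p := by linarith
  rw [hypEnergy, hypEnergy, derivative_augmentedOp hg f hz, enorm_mul,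
    mul_comm ‖derivative f.fn z‖ₑ, mul_assoc, ENNReal.mul_rpow_of_nonneg _ _ hp0]

theorem exists_enorm_extend_le {g : 𝔻 → ℂ} (hg : IsHInfty g) :
    ∃ M : ℝ, 0 < M ∧ ∀ z ∈ ball (0 : ℂ) 1, ‖extend g z‖ₑ ≤ ENNReal.ofReal M := by
  obtain ⟨-, M, hM⟩ := hg
  refine ⟨max M 1, by positivity, fun z hz => ?_⟩
  rw [extend_of_lt g (by simpa using hz), ← ofReal_norm]
  exact ENNReal.ofReal_le_ofReal ((hM _).trans (le_max_left _ _))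

theorem energy_augmentedOp_le {g : 𝔻 → ℂ} (hg : IsHInfty g) {M : ℝ≥0∞}
    (hMg : ∀ z ∈ ball (0 : ℂ) 1, ‖extend g z‖ₑ ≤ M) (f : Besov p hp) :
    energy p (augmentedOp p hp g hg f).fn ≤ M ^ p * energy p f.fn := by
  have hp0 : 0 ≤ p := by linarith
  rw [energy, energy, mul_left_comm,
    ← lintegral_const_mul _ (measurable_hypEnergy p (measurable_derivative f.fn))]
  refine mul_le_mul_right (lintegral_mono_ae ?_) _
  filter_upwards [ae_hypMeasure_mem_ball] with z hz
  rw [hypEnergy_augmentedOp hg f hz]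
  gcongr
  exact hMg z hz

theorem norm_le_mul_norm_iff {f h : Besov p hp} {C : ℝ} (hC : 0 ≤ C) :
    ‖f‖ ≤ C * ‖h‖ ↔ ‖f‖ₑ ^ p ≤ ENNReal.ofReal C ^ p * ‖h‖ₑ ^ p := by
  have hp0 : 0 < p := by linarith
  rw [← ENNReal.mul_rpow_of_nonneg _ _ hp0.le, ENNReal.rpow_le_rpow_iff hp0, ← ofReal_norm,
    ← ofReal_norm, ← ENNReal.ofReal_mul hC, ENNReal.ofReal_le_ofReal_iff (by positivity)]

theorem exists_norm_augmentedOp_le {g : 𝔻 → ℂ} (hg : IsHInfty g) :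
    ∃ C : ℝ, ∀ f : Besov p hp, ‖augmentedOp p hp g hg f‖ ≤ C * ‖f‖ := by
  have hp0 : 0 ≤ p := by linarith
  obtain ⟨M, hM, hMg⟩ := exists_enorm_extend_le hg
  refine ⟨max M 1, fun f => (norm_le_mul_norm_iff (by positivity)).2 ?_⟩
  have h1 : 1 ≤ ENNReal.ofReal (max M 1) := by simp
  rw [enorm_augmentedOp_rpow, enorm_rpow_eq, mul_add]
  refine add_le_add ?_ ?_
  · exact le_mul_of_one_le_left' (ENNReal.one_le_rpow h1 (by linarith))
  · refine energy_augmentedOp_le hg (fun z hz => (hMg z hz).trans ?_) f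
    exact ENNReal.ofReal_le_ofReal (le_max_left _ _)

/-- If `f' g = 0` on the connected disc, one factor vanishes identically. It is not `g`, so `f' =
0`, and `f(0) = 0` is retained by the operator. -/
theorem augmentedOp_injective {g : 𝔻 → ℂ} (hg : IsHInfty g) (hg0 : ∃ z, g z ≠ 0) :
    Function.Injective (augmentedOp p hp g hg) := by
  rw [injective_iff_map_eq_zero]
  intro f hf
  have h0 : f.fn 0 = 0 := by
    rw [← augmentedOp_fn_zero hg f, hf]; rfl
  have hprod : ∀ z ∈ ball (0 : ℂ) 1, derivative f.fn z * extend g z = 0 := fun z hz => by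
    rw [← derivative_augmentedOp hg f hz, hf]
    exact derivative_const 0 hz
  rcases AnalyticOnNhd.eq_zero_or_eq_zero_of_mul_eq_zero
    ((differentiableOn_derivative f.isAnalytic).analyticOnNhd isOpen_ball)
    (DifferentiableOn.analyticOnNhd hg.1 isOpen_ball) hprod
    (convex_ball (0 : ℂ) 1).isPreconnected with h | h
  · refine fn_injective (eq_of_derivative f.isAnalytic (isAnalytic_const 0) h0 fun z hz => ?_)
    exact (h z hz).trans (derivative_const 0 hz).symm
  · obtain ⟨z, hz⟩ := hg0
    refine absurd ?_ hz
    rw [← extend_coe g]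
    exact h z (by simpa using z.norm_lt_one)

/-- This moves the closed range question from the quotient to the complete space `B^p`, where the
kernel of constants is gone. -/
theorem range_augmentedOp {g : 𝔻 → ℂ} (hg : IsHInfty g) :
    range (augmentedOp p hp g hg) =
      (constants p hp).mkQ ⁻¹' range (integralOpZero p hp g hg) := by
  ext f
  constructor
  · rintro ⟨u, rfl⟩
    refine ⟨(constants p hp).mkQ u, ?_⟩
    rw [integralOpZero, Submodule.mkQ_apply, Submodule.mapQ_apply, Submodule.mkQ_apply,
      Submodule.Quotient.eq]
    refine ⟨-u.fn 0, fun z => ?_⟩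
    rw [fn_sub, Pi.sub_apply, augmentedOp_fn, integralOp_fn]
    ring
  · rintro ⟨q, hq⟩
    obtain ⟨u, rfl⟩ := (constants p hp).mkQ_surjective q
    rw [integralOpZero, Submodule.mkQ_apply, Submodule.mapQ_apply, Submodule.mkQ_apply,
      Submodule.Quotient.eq] at hq
    obtain ⟨k, hk⟩ := hq
    -- Here `f = S_g u - k`. Adding a constant to `u` does not change `S_g u`, and this one makes
    -- the value at `0` equal to `-k`.
    refine ⟨u + (-k - u.fn 0) • Besov.one p hp, fn_injective (funext fun z => ?_)⟩
    have hder : integralFn g (u + (-k - u.fn 0) • Besov.one p hp).fn = integralFn g u.fn := by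
      have s := integralFn_spec hg.1 (u + (-k - u.fn 0) • Besov.one p hp).isAnalytic
      have s' := integralFn_spec hg.1 u.isAnalytic
      refine eq_of_derivative s.1 s'.1 (by simp only [integralFn_apply_zero]) fun z hz => ?_
      rw [s.2 z hz, s'.2 z hz, fn_add, fn_smul,
        derivative_add u.isAnalytic (isAnalytic_smul _ (Besov.one p hp).isAnalytic) hz,
        derivative_smul]
      have : derivative (Besov.one p hp).fn z = 0 := derivative_const 1 hz
      rw [this, mul_zero, add_zero]
    have hz := hk z
    rw [fn_sub, Pi.sub_apply, integralOp_fn] at hz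
    rw [augmentedOp_fn, hder, fn_add, fn_smul, Pi.add_apply, Pi.smul_apply, one_fn, smul_eq_mul,
      mul_one]
    linear_combination hz

/-- `S_g` has closed range on `B^p / ℂ` if and only if `f ↦ f(0) + S_g f` is bounded below. -/
theorem isClosed_range_integralOpZero_iff {g : 𝔻 → ℂ} (hg : IsHInfty g) (hg0 : ∃ z, g z ≠ 0) :
    IsClosed (range (integralOpZero p hp g hg)) ↔
      ∃ C : ℝ, 0 < C ∧ ∀ f : Besov p hp, ‖f‖ ≤ C * ‖augmentedOp p hp g hg f‖ := by
  rw [← ((constants p hp).isOpenQuotientMap_mkQ.isQuotientMap).isClosed_preimage,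
    ← range_augmentedOp]
  obtain ⟨C, hC⟩ := exists_norm_augmentedOp_le (p := p) (hp := hp) hg
  -- Completeness of `B^p` enters here.
  have := ContinuousLinearMap.isClosed_range_iff_antilipschitz_of_injective
    ((augmentedOp p hp g hg).mkContinuous C hC) (augmentedOp_injective hg hg0)
  refine this.trans ⟨?_, ?_⟩
  · rintro ⟨K, hK⟩
    refine ⟨K + 1, by positivity, fun f => ?_⟩
    have := hK.le_mul_dist f 0
    rw [map_zero, dist_zero_right, dist_zero_right] at this
    refine this.trans ?_
    change K * ‖augmentedOp p hp g hg f‖ ≤ _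
    nlinarith [norm_nonneg (augmentedOp p hp g hg f)]
  · rintro ⟨C', hC', h⟩
    exact ⟨⟨C', hC'.le⟩, AddMonoidHomClass.antilipschitz_of_bound _ h⟩

/-! ### Superlevel sets -/

theorem superlevel_eq (g : 𝔻 → ℂ) (c : ℝ) :
    superlevel g c = ball 0 1 ∩ {z | c < ‖extend g z‖} := by
  ext z
  constructor
  · rintro ⟨w, rfl, hw⟩
    exact ⟨by simpa using w.norm_lt_one, by simpa [extend_coe] using hw⟩
  · rintro ⟨hz, hc⟩
    have hz' : ‖z‖ < 1 := by simpa using hz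
    exact ⟨Complex.UnitDisc.mk z hz', rfl, by simpa [extend_of_lt g hz'] using hc⟩

theorem measurableSet_superlevel {g : 𝔻 → ℂ} (hg : IsAnalytic g) (c : ℝ) :
    MeasurableSet (superlevel g c) := by
  rw [superlevel_eq]
  exact ((DifferentiableOn.continuousOn hg).norm.isOpen_inter_preimage isOpen_ball
    isOpen_Ioi).measurableSet

/-! ### Density of the superlevel sets implies the lower bound -/

/-- On the superlevel set `|f' g|^p ≥ c^p |f'|^p`, and Luecking's theorem recovers the whole energy
of `f` from that set. -/
theorem exists_norm_le_of_density {g : 𝔻 → ℂ} (hg : IsHInfty g) {c η σ : ℝ} (hc : 0 < c)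
    (h0 : 0 < η) (h1 : η < 1) (hσ : 0 < σ)
    (hdens : ∀ a : ℂ, ‖a‖ < 1 → ENNReal.ofReal σ ≤ hypMeasure (superlevel g c ∩ hypDisc η a)) :
    ∃ C : ℝ, 0 < C ∧ ∀ f : Besov p hp, ‖f‖ ≤ C * ‖augmentedOp p hp g hg f‖ := by
  have hp0 : 0 < p := by linarith
  have hs := measurableSet_superlevel hg.1 c
  obtain ⟨C, hC, H⟩ := exists_lintegral_hypEnergy_le hp0 h0 h1 hσ hs hdens
  have hcp : 0 < c ^ p := by positivity
  -- The `1` covers `|f(0)|^p`, the quotient covers the energy.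
  refine ⟨(1 + C / c ^ p) ^ (1 / p), by positivity, fun f => ?_⟩
  rw [norm_le_mul_norm_iff (by positivity), ENNReal.ofReal_rpow_of_nonneg (by positivity) hp0.le,
    ← Real.rpow_mul (by positivity), one_div_mul_cancel hp0.ne', Real.rpow_one,
    enorm_augmentedOp_rpow, enorm_rpow_eq, mul_add]
  set T := augmentedOp p hp g hg f
  have hfin : ∫⁻ z, hypEnergy p (derivative f.fn) z ∂hypMeasure ≠ ∞ := by
    rw [lintegral_hypEnergy_derivative]
    exact ENNReal.mul_ne_top measure_ball_lt_top.ne f.energy_ne_top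
  have hlow : ENNReal.ofReal (c ^ p) *
      (∫⁻ z in superlevel g c, hypEnergy p (derivative f.fn) z ∂hypMeasure) ≤
        ∫⁻ z, hypEnergy p (derivative T.fn) z ∂hypMeasure := by
    rw [← lintegral_const_mul' _ _ ENNReal.ofReal_ne_top]
    refine (setLIntegral_mono' hs fun z hz => ?_).trans
      (setLIntegral_le_lintegral (superlevel g c) _)
    rw [superlevel_eq] at hz
    rw [hypEnergy_augmentedOp hg f hz.1, ← ENNReal.ofReal_rpow_of_pos hc, ← ofReal_norm]
    gcongr
    exact hz.2.le
  have hmain := H _ (differentiableOn_derivative f.isAnalytic) (measurable_derivative f.fn) hfin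
  have h2 : energy p f.fn ≤ ENNReal.ofReal (C / c ^ p) * energy p T.fn := by
    rw [energy, energy, mul_left_comm]
    refine mul_le_mul_right (hmain.trans ?_) _
    refine le_trans (le_of_eq ?_) (mul_le_mul_right hlow _)
    rw [← mul_assoc, ← ENNReal.ofReal_mul (by positivity), div_mul_cancel₀ _ hcp.ne']
  refine add_le_add ?_ (h2.trans ?_)
  · refine le_mul_of_one_le_left' (ENNReal.one_le_ofReal.2 ?_)
    have : 0 < C / c ^ p := by positivity
    linarith
  · gcongr
    linarith

/-! ### The Möbius test functions -/

/-- The energy density of `z ↦ z`. -/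
def weight (p : ℝ) (z : ℂ) : ℝ≥0∞ := ENNReal.ofReal (1 - ‖z‖ ^ 2) ^ p

theorem measurable_weight (p : ℝ) : Measurable (weight p) := by unfold weight; fun_prop

/-- The antiderivative `-(1 - y^2)^(p - 1) / (2 (p - 1))` is continuous up to `y = 1` because `p >
1`, although the integrand blows up there when `p < 2`. -/
theorem integrableOn_mul_one_sub_sq_rpow (hp : 1 < p) :
    IntegrableOn (fun y : ℝ => y * (1 - y ^ 2) ^ (p - 2)) (Ioc 0 1) := by
  refine intervalIntegral.integrableOn_deriv_of_nonneg
    (g := fun y => -(1 - y ^ 2) ^ (p - 1) / (2 * (p - 1))) ?_ (fun y hy => ?_) fun y hy => ?_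
  · refine ContinuousOn.div_const (ContinuousOn.neg ?_) _
    exact ContinuousOn.rpow_const (by fun_prop) fun _ _ => Or.inr (by linarith)
  · have hpos : 0 < 1 - y ^ 2 := by nlinarith [hy.1, hy.2]
    have h1 : HasDerivAt (fun y : ℝ => 1 - y ^ 2) (-(2 * y)) y := by
      simpa using ((hasDerivAt_id y).pow 2).const_sub 1
    have h2 := ((h1.rpow_const (p := p - 1) (Or.inl hpos.ne')).neg).div_const (2 * (p - 1))
    refine h2.congr_deriv ?_
    have : p - 1 ≠ 0 := by linarith
    rw [show p - 1 - 1 = p - 2 by ring]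
    field_simp
  · have hpos : 0 < 1 - y ^ 2 := by nlinarith [hy.1, hy.2]
    exact mul_nonneg hy.1.le (Real.rpow_nonneg hpos.le _)

/-- Polar coordinates reduce this to `integrableOn_mul_one_sub_sq_rpow`. -/
theorem lintegral_weight_ne_top (hp : 1 < p) : ∫⁻ z, weight p z ∂hypMeasure ≠ ∞ := by
  have hp0 : 0 ≤ p := by linarith
  set φ : ℝ → ℝ := (Iio 1).indicator fun y => (1 - y ^ 2) ^ (p - 2) with hφ
  have hint : Integrable (fun z : ℂ => φ ‖z‖) := by
    rw [integrable_fun_norm_addHaar, Complex.finrank_real_complex]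
    have e : (fun y : ℝ => y ^ (2 - 1) • φ y) =
        (Iio 1).indicator fun y : ℝ => y * (1 - y ^ 2) ^ (p - 2) := by
      funext y
      by_cases hy : y ∈ Iio (1 : ℝ) <;> simp [hφ, hy]
    rw [e, integrableOn_indicator_iff measurableSet_Iio]
    exact (integrableOn_mul_one_sub_sq_rpow hp).mono_set fun y hy =>
      ⟨hy.2, (show y < 1 from hy.1).le⟩
  have hle : ∫⁻ z, weight p z ∂hypMeasure ≤ ∫⁻ z : ℂ, ‖φ ‖z‖‖ₑ := by
    rw [lintegral_hypMeasure]
    refine le_trans (le_of_eq (setLIntegral_congr_fun measurableSet_ball fun z hz => ?_))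
      (setLIntegral_le_lintegral (ball (0 : ℂ) 1) fun z => ‖φ ‖z‖‖ₑ)
    have hz' : ‖z‖ < 1 := by simpa using hz
    have hw := one_sub_norm_sq_pos hz'
    rw [weight, ENNReal.ofReal_rpow_of_pos hw, ← ENNReal.ofReal_mul (by positivity), hφ,
      indicator_of_mem (show ‖z‖ ∈ Iio (1 : ℝ) from hz'), Real.enorm_of_nonneg (by positivity),
      Real.rpow_sub hw, Real.rpow_two]
    congr 1
    field_simp
  exact ne_top_of_le_ne_top (ne_of_lt hint.2) hle

theorem lintegral_weight_ne_zero (hp : 1 < p) : ∫⁻ z, weight p z ∂hypMeasure ≠ 0 := by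
  have hp0 : 0 < p := by linarith
  rw [← pos_iff_ne_zero]
  refine lt_of_lt_of_le ?_ (setLIntegral_le_lintegral (ball 0 (1 / 2)) _)
  refine (setLIntegral_pos_iff (measurable_weight p)).2 ?_
  refine (hypMeasure_ball_pos (η := 1 / 2) (by norm_num) (by norm_num)).trans_le
    (measure_mono fun z hz => ⟨?_, hz⟩)
  have hz' : ‖z‖ < 1 / 2 := by simpa using hz
  exact (ENNReal.rpow_pos (ENNReal.ofReal_pos.2 (one_sub_norm_sq_pos (by linarith)))
    ENNReal.ofReal_ne_top).ne'

/-- The weight has small mass near the boundary. -/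
theorem exists_setLIntegral_weight_le (hp : 1 < p) {ε : ℝ} (hε : 0 < ε) :
    ∃ η : ℝ, 0 < η ∧ η < 1 ∧
      ∫⁻ z in (ball (0 : ℂ) η)ᶜ, weight p z ∂hypMeasure ≤ ENNReal.ofReal ε := by
  -- The shift by `2` keeps every radius strictly between `0` and `1`.
  set r : ℕ → ℝ := fun n => 1 - 1 / ((n : ℝ) + 2) with hr
  have hr0 : ∀ n, 0 < r n := fun n => by
    have : 1 / ((n : ℝ) + 2) < 1 := by
      rw [div_lt_one (by positivity)]; linarith [n.cast_nonneg (α := ℝ)]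
    simp only [hr]; linarith
  have hr1 : ∀ n, r n < 1 := fun n => by
    have : 0 < 1 / ((n : ℝ) + 2) := by positivity
    simp only [hr]; linarith
  have hrt : Tendsto r atTop (𝓝 1) := by
    have h1 : Tendsto (fun n : ℕ => 1 / ((n : ℝ) + 2)) atTop (𝓝 0) :=
      tendsto_const_nhds.div_atTop (tendsto_atTop_add_const_right _ _ tendsto_natCast_atTop_atTop)
    have h2 := h1.const_sub 1
    rwa [sub_zero] at h2
  have hlim : Tendsto (fun n => ∫⁻ z, (ball (0 : ℂ) (r n))ᶜ.indicator (weight p) z ∂hypMeasure)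
      atTop (𝓝 (∫⁻ _, 0 ∂hypMeasure)) := by
    refine tendsto_lintegral_of_dominated_convergence (weight p)
      (fun n => (measurable_weight p).indicator measurableSet_ball.compl)
      (fun n => Eventually.of_forall fun z => indicator_le_self _ _ z)
      (lintegral_weight_ne_top hp) ?_
    filter_upwards [ae_hypMeasure_mem_ball] with z hz
    refine tendsto_const_nhds.congr' ?_
    filter_upwards [hrt.eventually_const_lt (show ‖z‖ < 1 by simpa using hz)] with n hn
    rw [indicator_of_notMem]
    simpa using hn
  rw [lintegral_zero] at hlim
  obtain ⟨n, hn⟩ := (hlim.eventually_le_const (ENNReal.ofReal_pos.2 hε)).exists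
  refine ⟨r n, hr0 n, hr1 n, ?_⟩
  rwa [lintegral_indicator measurableSet_ball.compl] at hn

theorem moebius_test_spec (a : 𝔻) :
    IsAnalytic (fun z : 𝔻 => moebius a z - a) ∧ ∀ z ∈ ball (0 : ℂ) 1,
      derivative (fun z : 𝔻 => moebius a z - a) z = deriv (moebius a) z :=
  isAnalytic_of_hasDerivAt (F := fun z => moebius a z - a) (fun z hz =>
    ((hasDerivAt_moebius a.norm_lt_one
      (by simpa using hz)).differentiableAt.hasDerivAt.sub_const _)) fun _ => rfl

theorem hypEnergy_moebius_test (p : ℝ) (a : 𝔻) {z : ℂ} (hz : z ∈ ball (0 : ℂ) 1) :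
    hypEnergy p (derivative fun z : 𝔻 => moebius a z - a) z = weight p (moebius a z) := by
  rw [hypEnergy, (moebius_test_spec a).2 z hz, weight, ← ofReal_norm,
    ← ENNReal.ofReal_mul (norm_nonneg _), norm_deriv_moebius a.norm_lt_one (by simpa using hz)]

/-- Independence of `a` is what makes the resulting density estimate uniform. -/
theorem lintegral_hypEnergy_moebius_test (p : ℝ) (a : 𝔻) :
    ∫⁻ z, hypEnergy p (derivative fun z : 𝔻 => moebius a z - a) z ∂hypMeasure =
      ∫⁻ z, weight p z ∂hypMeasure := by
  rw [← lintegral_moebius_hypMeasure a.norm_lt_one (weight p)]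
  refine lintegral_congr_ae ?_
  filter_upwards [ae_hypMeasure_mem_ball] with z hz using hypEnergy_moebius_test p a hz

/-- The function `φ_a - φ_a(0)` in `B^p`. -/
def moebiusTest (p : ℝ) (hp : 1 < p) (a : 𝔻) : Besov p hp :=
  ⟨fun z => moebius a z - a, (mem_besovSubmodule_iff hp).2 ⟨(moebius_test_spec a).1, by
    rw [energy, lintegral_hypEnergy_moebius_test]
    exact ENNReal.mul_ne_top volume_ball_inv_ne_top (lintegral_weight_ne_top hp)⟩⟩

theorem moebiusTest_zero (a : 𝔻) : (moebiusTest p hp a).fn 0 = 0 := by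
  change moebius a ((0 : 𝔻) : ℂ) - a = 0
  simp [moebius_zero_right]

/-! ### The lower bound implies density of the superlevel sets -/

/-- The lower bound for the test function `moebiusTest p hp a`. -/
theorem lintegral_weight_le {g : 𝔻 → ℂ} (hg : IsHInfty g) {K : ℝ} (hK : 0 < K)
    (hlow : ∀ f : Besov p hp, ‖f‖ ≤ K * ‖augmentedOp p hp g hg f‖) (a : 𝔻) :
    ∫⁻ z, weight p z ∂hypMeasure ≤
      ENNReal.ofReal K ^ p * ∫⁻ z, ‖extend g z‖ₑ ^ p * weight p (moebius a z) ∂hypMeasure := by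
  have hp0 : 0 < p := by linarith
  have h := (norm_le_mul_norm_iff hK.le).1 (hlow (moebiusTest p hp a))
  rw [enorm_augmentedOp_rpow, enorm_rpow_eq, moebiusTest_zero, enorm_zero,
    ENNReal.zero_rpow_of_pos hp0, zero_add, zero_add, energy, energy, mul_left_comm,
    ENNReal.mul_le_mul_iff_right volume_ball_inv_ne_zero volume_ball_inv_ne_top] at h
  refine (lintegral_hypEnergy_moebius_test p a).symm.le.trans (h.trans (le_of_eq ?_))
  congr 1
  refine lintegral_congr_ae ?_
  filter_upwards [ae_hypMeasure_mem_ball] with z hz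
  rw [hypEnergy_augmentedOp hg _ hz]
  congr 1
  exact hypEnergy_moebius_test p a hz

/-- The energy `I` of the test function is at most `K^p` times its `|g|^p`-weighted energy. The
latter splits into the part off `G_c`, the part in `G_c` near `a`, and a small tail, so the middle
part cannot be negligible. -/
theorem exists_density_of_norm_le {g : 𝔻 → ℂ} (hg : IsHInfty g) {K : ℝ} (hK : 0 < K)
    (hlow : ∀ f : Besov p hp, ‖f‖ ≤ K * ‖augmentedOp p hp g hg f‖) :
    ∃ c η σ : ℝ, 0 < c ∧ 0 < η ∧ η < 1 ∧ 0 < σ ∧ ∀ a : ℂ, ‖a‖ < 1 →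
      ENNReal.ofReal σ ≤ hypMeasure (superlevel g c ∩ hypDisc η a) := by
  have hp0 : 0 < p := by linarith
  obtain ⟨M, hM, hMg⟩ := exists_enorm_extend_le hg
  obtain ⟨I, hI0, hI⟩ : ∃ I : ℝ, 0 < I ∧ ∫⁻ z, weight p z ∂hypMeasure = ENNReal.ofReal I :=
    ⟨_, ENNReal.toReal_pos (lintegral_weight_ne_zero hp) (lintegral_weight_ne_top hp),
      (ENNReal.ofReal_toReal (lintegral_weight_ne_top hp)).symm⟩
  set Q := (K * M) ^ p with hQ
  have hQ0 : 0 < Q := by positivity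
  -- Chosen so that `(K * c) ^ p = 1 / 2`: the part off the superlevel set accounts for at most half
  -- of `I`.
  set c := (1 / 2) ^ (1 / p) / K with hc
  have hc0 : 0 < c := by positivity
  have hKc : (K * c) ^ p = 1 / 2 := by
    rw [hc, mul_div_cancel₀ _ hK.ne', ← Real.rpow_mul (by norm_num), one_div_mul_cancel hp0.ne',
      Real.rpow_one]
  obtain ⟨η, h0, h1, htail⟩ := exists_setLIntegral_weight_le hp (ε := I / (8 * Q)) (by positivity)
  refine ⟨c, η, I / (8 * Q), hc0, h0, h1, by positivity, fun a ha => ?_⟩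
  by_contra! hlt
  have hs := measurableSet_superlevel hg.1 c
  rw [hypMeasure_inter_hypDisc ha hs] at hlt
  set E := moebius a ⁻¹' superlevel g c with hE
  have hEm : MeasurableSet E := measurable_moebius a hs
  have hmass : ∫⁻ z in superlevel g c, weight p (moebius a z) ∂hypMeasure ≤
      ENNReal.ofReal (I / (8 * Q)) + ENNReal.ofReal (I / (8 * Q)) := by
    have e : ∫⁻ z in superlevel g c, weight p (moebius a z) ∂hypMeasure =
        ∫⁻ z in E, weight p z ∂hypMeasure := by
      rw [← lintegral_indicator hs, ← lintegral_indicator hEm,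
        ← lintegral_moebius_hypMeasure ha (E.indicator _)]
      refine lintegral_congr_ae ?_
      filter_upwards [ae_hypMeasure_mem_ball] with z hz
      have : moebius a z ∈ E ↔ z ∈ superlevel g c := by
        rw [hE, mem_preimage, moebius_moebius ha (by simpa using hz)]
      by_cases hz : z ∈ superlevel g c
      · rw [indicator_of_mem hz, indicator_of_mem (this.2 hz)]
      · rw [indicator_of_notMem hz, indicator_of_notMem (mt this.1 hz)]
    rw [e, ← lintegral_inter_add_sdiff (weight p) E (measurableSet_ball (x := (0 : ℂ)) (ε := η))]
    -- Inside `ball 0 η` the weight is at most `1`, so its integral is bounded by the measure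
    -- assumed small; outside, the tail bound applies.
    refine add_le_add (le_trans ?_ hlt.le) (le_trans (lintegral_mono_set fun z hz => hz.2) htail)
    rw [← setLIntegral_one]
    refine lintegral_mono fun z => ?_
    exact ENNReal.rpow_le_one (ENNReal.ofReal_le_one.2 (by nlinarith [norm_nonneg z])) hp0.le
  have hsplit : ∫⁻ z, ‖extend g z‖ₑ ^ p * weight p (moebius a z) ∂hypMeasure ≤
      ENNReal.ofReal M ^ p * (∫⁻ z in superlevel g c, weight p (moebius a z) ∂hypMeasure) +
        ENNReal.ofReal c ^ p * ENNReal.ofReal I := by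
    have hwm : Measurable fun z => weight p (moebius a z) :=
      (measurable_weight p).comp (measurable_moebius a)
    rw [← hI, ← lintegral_moebius_hypMeasure ha (weight p), ← lintegral_indicator hs,
      ← lintegral_const_mul' _ _ (by simp [hp0.le]), ← lintegral_const_mul' _ _ (by simp [hp0.le]),
      ← lintegral_add_right _ (hwm.const_mul _)]
    refine lintegral_mono_ae ?_
    filter_upwards [ae_hypMeasure_mem_ball] with z hz
    by_cases hzs : z ∈ superlevel g c
    · rw [indicator_of_mem hzs]
      refine le_trans ?_ le_self_add
      gcongr
      exact hMg z hz
    · refine le_trans ?_ le_add_self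
      gcongr
      rw [← ofReal_norm]
      refine ENNReal.ofReal_le_ofReal (not_lt.1 fun h => hzs ?_)
      rw [superlevel_eq]
      exact ⟨hz, h⟩
  have hfinal := (lintegral_weight_le hg hK hlow (Complex.UnitDisc.mk a ha)).trans
    (mul_le_mul_right (hsplit.trans (add_le_add_left (mul_le_mul_right hmass _) _)) _)
  rw [hI, ← ENNReal.ofReal_add (by positivity) (by positivity),
    ENNReal.ofReal_rpow_of_pos hM, ENNReal.ofReal_rpow_of_pos hc0, ENNReal.ofReal_rpow_of_pos hK,
    ← ENNReal.ofReal_mul (by positivity), ← ENNReal.ofReal_mul (by positivity),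
    ← ENNReal.ofReal_add (by positivity) (by positivity), ← ENNReal.ofReal_mul (by positivity),
    ENNReal.ofReal_le_ofReal_iff (by positivity), mul_add, ← mul_assoc, ← mul_assoc,
    ← Real.mul_rpow hK.le hM.le, ← Real.mul_rpow hK.le hc0.le, hKc, ← hQ] at hfinal
  -- The contradiction is `I ≤ I / 4 + I / 2`.
  have : Q * (I / (8 * Q) + I / (8 * Q)) = I / 4 := by field_simp; norm_num
  linarith

/-! ### From normalized area to Lebesgue measure -/

theorem areaMeasure_real_of_subset {s : Set ℂ} (hs : MeasurableSet s) (hb : s ⊆ ball 0 1) :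
    areaMeasure.real s = (volume (ball (0 : ℂ) 1))⁻¹.toReal * (volume s).toReal := by
  rw [Measure.real, areaMeasure, Measure.smul_apply, Measure.restrict_apply hs,
    inter_eq_left.2 hb, smul_eq_mul, ENNReal.toReal_mul]

/-- The normalizing factor cancels, and all the measures are finite, so passing to real values loses
nothing. -/
theorem mul_areaMeasure_real_le_iff {s : Set ℂ} (hs : MeasurableSet s) {δ : ℝ} (hδ : 0 < δ)
    (η : ℝ) (a : ℂ) :
    δ * areaMeasure.real (hypDisc η a) ≤ areaMeasure.real (s ∩ hypDisc η a) ↔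
      ENNReal.ofReal δ * volume (hypDisc η a) ≤ volume (s ∩ hypDisc η a) := by
  have hD := measurableSet_hypDisc η a
  have hb := hypDisc_subset_ball η a
  have ht : ∀ t ⊆ ball (0 : ℂ) 1, volume t ≠ ∞ := fun t h =>
    measure_ne_top_of_subset h measure_ball_lt_top.ne
  have hb' : s ∩ hypDisc η a ⊆ ball 0 1 := inter_subset_right.trans hb
  rw [areaMeasure_real_of_subset hD hb, areaMeasure_real_of_subset (hs.inter hD) hb',
    mul_left_comm, mul_le_mul_iff_right₀
      (ENNReal.toReal_pos volume_ball_inv_ne_zero volume_ball_inv_ne_top),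
    ← ENNReal.toReal_le_toReal (ENNReal.mul_ne_top ENNReal.ofReal_ne_top (ht _ hb)) (ht _ hb'),
    ENNReal.toReal_mul, ENNReal.toReal_ofReal hδ.le]

end BesovRange

end

theorem mainTheorem3 (p : ℝ) (hp : 1 < p) (g : Complex.UnitDisc → ℂ)
    (hg : BesovRange.IsHInfty g) (hg0 : ∃ z, g z ≠ 0) :
    IsClosed (Set.range (BesovRange.integralOpZero p hp g hg)) ↔
      ∃ c δ η : ℝ, 0 < c ∧ 0 < δ ∧ 0 < η ∧ η < 1 ∧
        ∀ a : Complex.UnitDisc,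
          BesovRange.areaMeasure.real
              (BesovRange.superlevel g c ∩ BesovRange.pseudoDisc η a) ≥
            δ * BesovRange.areaMeasure.real (BesovRange.pseudoDisc η a) := by
  open BesovRange in
  rw [isClosed_range_integralOpZero_iff hg hg0]
  have hms := measurableSet_superlevel hg.1
  constructor
  · rintro ⟨K, hK, hlow⟩
    obtain ⟨c, η, σ, hc, h0, h1, hσ, H⟩ := exists_density_of_norm_le hg hK hlow
    obtain ⟨δ, hδ, Hδ⟩ := (exists_volume_density_iff (hms c) h0 h1).2 ⟨σ, hσ, H⟩
    refine ⟨c, δ, η, hc, hδ, h0, h1, fun a => ?_⟩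
    rw [pseudoDisc_eq]
    exact (mul_areaMeasure_real_le_iff (hms c) hδ η a).2 (Hδ a a.norm_lt_one)
  · rintro ⟨c, δ, η, hc, hδ, h0, h1, H⟩
    obtain ⟨σ, hσ, Hσ⟩ := (exists_volume_density_iff (hms c) h0 h1).1 ⟨δ, hδ, fun a ha => by
      have := H (Complex.UnitDisc.mk a ha)
      rw [pseudoDisc_eq] at this
      exact (mul_areaMeasure_real_le_iff (hms c) hδ η a).1 this⟩
    exact exists_norm_le_of_density hg hc h0 h1 hσ Hσ
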